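/- Let $\mathbb{S}^2\subset\mathbb{R}^3$ be the unit sphere with surface measure $\sigma$ and surface gradient $\nabla$, let $d(x,p)\in[0,\pi]$ be the geodesic distance from $x$ to a fixed point $p\in\mathbb{S}^2$, and let $H^1(\mathbb{S}^2)$ be the completion of the space of real-valued functions $C^\infty(\mathbb{S}^2)$ in the norm $\big(\|f\|_{L^2}^2+\|\nabla f\|_{L^2}^2\big)^{1/2}$. Put $\phi(t)=\log(\pi e/t)$, $\psi(t)=\phi(\sin t)$ and, for $\eta\in\{\phi,\psi\}$, $\rho_\eta(t)=t\,\eta(t)$. For $f\in H^1(\mathbb{S}^2)$ and a constant $C>0$ let $$Q(f;\eta)=\frac14\int_{\mathbb{S}^2}\left(\frac{f^2}{\rho_\eta^2(d(x,p))}+\frac{f^2}{\rho_\eta^2(\pi-d(x,p))}\right)d\sigma,\qquad T_C(f)=\int_{\mathbb{S}^2}|\nabla f|^2\,d\sigma+\frac{C}{4}\int_{\mathbb{S}^2}f^2\,d\sigma .$$ Let $A$ and $B$ be any constants with $$A\ \ge\ \frac{2}{1+\log\pi}+\frac{8}{(1+\log 2)^2}\,\frac1{\pi^2},\qquad B\ \ge\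 \frac{2}{1+\log\pi}+\frac{8}{(1+\log\pi)^2}\,\frac1{\pi^2}.$$ Then there is no $f\in H^1(\mathbb{S}^2)\setminus\{0\}$ with $Q(f;\phi)=T_A(f)$, and there is no $f\in H^1(\mathbb{S}^2)\setminus\{0\}$ with $Q(f;\psi)=T_B(f)$. -/

import Mathlib

open MeasureTheory Metric
open scoped Manifold ContDiff ENNReal

noncomputable section

/-- Euclidean three-space. -/
abbrev E3 : Type := EuclideanSpace ℝ (Fin 3)

/-- The unit sphere `𝕊²` in `ℝ³`. -/
abbrev S2 : Type := sphere (0 : E3) 1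

/-- The surface measure `σ` on `𝕊²` induced by the Lebesgue measure of `ℝ³`. -/
abbrev surf : Measure S2 := (volume : Measure E3).toSphere

/-- The smooth real-valued functions on the manifold `𝕊²`. -/
def SmoothOnS2 (u : S2 → ℝ) : Prop := ContMDiff (𝓡 2) 𝓘(ℝ, ℝ) ∞ u

/-- The radial projection `ℝ³ ∖ {0} → 𝕊²`, `y ↦ y / ‖y‖` (with an arbitrary value at `0`). -/
def radialProj (y : E3) : S2 :=
  if h : y = 0 then ⟨EuclideanSpace.single 0 1, by simp⟩
  else ⟨‖y‖⁻¹ • y, by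
    rw [mem_sphere_zero_iff_norm, norm_smul, norm_inv, norm_norm,
      inv_mul_cancel₀ (norm_ne_zero_iff.mpr h)]⟩

/-- The surface gradient of `u : 𝕊² → ℝ`, as a vector field with values in `ℝ³`: the gradient of
the extension of `u` which is constant on rays. -/
def surfGrad (u : S2 → ℝ) (x : S2) : E3 := gradient (fun y : E3 => u (radialProj y)) (x : E3)

/-- The Hilbert space `L²(𝕊²) ⊕ L²(𝕊² → ℝ³)`. Its norm on a pair `(f, V)` is
`(‖f‖²_{L²} + ‖V‖²_{L²})^{1/2}`. -/
abbrev L2Pair : Type := WithLp 2 (Lp ℝ 2 surf × Lp E3 2 surf)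

/-- The Sobolev space `H¹(𝕊²)`: the completion of `C^∞(𝕊²)` in the norm
`(‖u‖²_{L²} + ‖∇u‖²_{L²})^{1/2}`, realised as the closure in the Hilbert space of pairs of the
isometric image `{(u, ∇u)}` of `C^∞(𝕊²)`. An element is a pair `(f, ∇f)`. -/
def H1S2 : Set L2Pair :=
  closure {w : L2Pair | ∃ u : S2 → ℝ, SmoothOnS2 u ∧
    (w.fst : S2 → ℝ) =ᵐ[surf] u ∧ (w.snd : S2 → E3) =ᵐ[surf] surfGrad u}

/-- The geodesic distance on `𝕊²`: the angle, in `[0, π]`, between the two unit vectors. -/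
def geoDist (x p : S2) : ℝ := InnerProductGeometry.angle (x : E3) (p : E3)

/-- `φ(t) = log (π e / t)`. -/
def phi (t : ℝ) : ℝ := Real.log (Real.pi * Real.exp 1 / t)

/-- `ψ(t) = φ(sin t)`. -/
def psi (t : ℝ) : ℝ := phi (Real.sin t)

/-- `ρ_η(t) = t η(t)`. -/
def rho (η : ℝ → ℝ) (t : ℝ) : ℝ := t * η t

/-- `T_A(f) = ∫ |∇f|² dσ + (A/4) ∫ f² dσ`. -/
def TFun (A : ℝ) (f : L2Pair) : ℝ≥0∞ :=
  ∫⁻ x, ENNReal.ofReal (‖f.snd x‖ ^ 2) ∂surf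
    + ENNReal.ofReal (A / 4) * ∫⁻ x, ENNReal.ofReal (f.fst x ^ 2) ∂surf

/-- `Q(f; η) = (1/4) ∫ (f² / ρ_η(d(x,p))² + f² / ρ_η(π - d(x,p))²) dσ`. -/
def QFun (η : ℝ → ℝ) (p : S2) (f : L2Pair) : ℝ≥0∞ :=
  ENNReal.ofReal (1 / 4) * ∫⁻ x, ENNReal.ofReal
    (f.fst x ^ 2 / rho η (geoDist x p) ^ 2
      + f.fst x ^ 2 / rho η (Real.pi - geoDist x p) ^ 2) ∂surf

/-- The constant `A` of the inequality `Q(f; φ) ≤ T_A(f)`. -/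
def constA : ℝ :=
  2 / (1 + Real.log Real.pi) + 8 / (1 + Real.log 2) ^ 2 * (1 / Real.pi ^ 2)

/-- The constant `B` of the inequality `Q(f; ψ) ≤ T_B(f)`. -/
def constB : ℝ :=
  2 / (1 + Real.log Real.pi) + 8 / (1 + Real.log Real.pi) ^ 2 * (1 / Real.pi ^ 2)

end

/-!
Let `t` be the geodesic distance to `p` and `z = cos t = ⟪x, p⟫`. For a tangent field `W` on `𝕊²`,
integrating `0 ≤ |∇u + u W|²` gives `∫ u² (div W - |W|²) ≤ ∫ |∇u|²`. The field
`W = -(z / (2 (1 - z²) ψ)) (p - z x)`, which is `-∇ log √ψ`, yields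
`∫ u² (H + k) ≤ ∫ |∇u|² + k ∫ u²` with `H = cos² t / (4 sin² t ψ²) - 1 / (2 ψ)` (`hardyWeight`) and
`k = 1 / (2 (1 + log π))`, where `H + k ≥ 0` since `ψ ≥ 1 + log π`. As `W` is singular at the two
poles, `1 - z²` is first replaced by `1 - c z²` with `c < 1` (`regField`, `regWeight_le`). Fatou's
lemma then gives the limit `c → 1` and the passage from `C^∞(𝕊²)` to `H¹(𝕊²)`
(`lintegral_hardy_le_of_mem_H1S2`).

The divergence theorem needed for fields `g(z) (p - z x)` is deduced from integration by parts in
`ℝ³`: the extension of a function constant on rays, times a radial cut-off, is integrated against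
the polynomial field `‖y‖² p - ⟪y, p⟫ y` in polar coordinates
(`integral_inner_surfGrad_meridian`).

Off the poles and the equator the weight of `Q` is strictly smaller than `H + constA / 4` for `φ`
and than `H + constB / 4` for `ψ` (`rho_phi_weight_lt`, `rho_psi_weight_lt`); at the equator there is
equality, which is what determines the constants. As the exceptional set is null, `Q(f) = T(f)`
forces `f = 0` almost everywhere, hence `Q(f) = 0` and `∇f = 0` (`QFun_ne_TFun`).
-/

/-! ### The pointwise inequality between the weights -/

theorem log_pi_bounds : 1.05 ≤ Real.log Real.pi ∧ Real.log Real.pi ≤ 1.172 := by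
  have h2 := Real.log_two_gt_d9
  have h2' := Real.log_two_lt_d9
  have hp := Real.pi_gt_d4
  have hp' := Real.pi_lt_d4
  constructor
  · have h : Real.log Real.pi = Real.log 2 - Real.log (2 / Real.pi) := by
      rw [Real.log_div (by norm_num) Real.pi_ne_zero]; ring
    have h3 := Real.log_le_sub_one_of_pos (x := 2 / Real.pi) (by positivity)
    have h4 : 2 / Real.pi ≤ 0.6367 := by
      rw [div_le_iff₀ Real.pi_pos]; linarith
    linarith
  · have h : Real.log Real.pi = 2 * Real.log 2 + Real.log (Real.pi / 4) := by
      rw [Real.log_div Real.pi_ne_zero (by norm_num), show (4 : ℝ) = 2 ^ 2 by norm_num,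
        Real.log_pow]
      push_cast; ring
    have h3 := Real.log_le_sub_one_of_pos (x := Real.pi / 4) (by positivity)
    linarith

theorem log_cos_le_neg_sq_half {x : ℝ} (h0 : 0 ≤ x) (h1 : x < Real.pi / 2) :
    Real.log (Real.cos x) ≤ -(x ^ 2 / 2) := by
  have hanti : AntitoneOn (fun y : ℝ => Real.log (Real.cos y) + y ^ 2 / 2)
      (Set.Ico 0 (Real.pi / 2)) := by
    have hpos : ∀ y ∈ Set.Ico (0 : ℝ) (Real.pi / 2), 0 < Real.cos y := fun y hy =>
      Real.cos_pos_of_mem_Ioo ⟨by linarith [hy.1, Real.pi_pos], hy.2⟩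
    have hder : ∀ y ∈ Set.Ico (0 : ℝ) (Real.pi / 2),
        HasDerivAt (fun y : ℝ => Real.log (Real.cos y) + y ^ 2 / 2)
          (-Real.tan y + y) y := by
      intro y hy
      have h := ((Real.hasDerivAt_cos y).log (hpos y hy).ne').add
        (((hasDerivAt_id y).pow 2).div_const 2)
      refine h.congr_deriv ?_
      rw [Real.tan_eq_sin_div_cos]
      simp
      ring
    refine antitoneOn_of_deriv_nonpos (convex_Ico _ _)
      (fun y hy => (hder y hy).continuousAt.continuousWithinAt)
      (fun y hy => ((hder y (interior_subset hy)).differentiableAt).differentiableWithinAt) ?_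
    intro y hy
    rw [(hder y (interior_subset hy)).deriv]
    rw [interior_Ico] at hy
    linarith [Real.lt_tan hy.1 hy.2]
  have h := hanti (Set.mem_Ico.2 ⟨le_rfl, by linarith [Real.pi_pos]⟩) (Set.mem_Ico.2 ⟨h0, h1⟩) h0
  simp at h
  linarith

theorem phi_eq {t : ℝ} (ht : 0 < t) : phi t = 1 + Real.log Real.pi - Real.log t := by
  unfold phi
  rw [Real.log_div (by positivity) ht.ne', Real.log_mul Real.pi_ne_zero (Real.exp_ne_zero _),
    Real.log_exp]
  ring

theorem one_add_log_pi_le_psi {t : ℝ} (h0 : 0 < t) (h1 : t < Real.pi) :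
    1 + Real.log Real.pi ≤ psi t := by
  have hs := Real.sin_pos_of_pos_of_lt_pi h0 h1
  rw [psi, phi_eq hs]
  linarith [Real.log_nonpos hs.le (Real.sin_le_one t)]

theorem rho_phi_mono {s t : ℝ} (hs : 0 < s) (hst : s ≤ t) (ht : t ≤ Real.pi) :
    rho phi s ≤ rho phi t := by
  have ht0 := hs.trans_le hst
  rw [rho, rho, phi_eq hs, phi_eq ht0]
  have h1 : Real.log t - Real.log s ≤ t / s - 1 := by
    rw [← Real.log_div ht0.ne' hs.ne']
    exact Real.log_le_sub_one_of_pos (by positivity)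
  have h2 : s * (Real.log t - Real.log s) ≤ t - s := by
    calc _ ≤ s * (t / s - 1) := by gcongr
      _ = _ := by field_simp
  have h3 := mul_nonneg (sub_nonneg.2 hst) (sub_nonneg.2 (Real.log_le_log ht0 ht))
  nlinarith

/-- With `t = (π/2)(1 ∓ u)` and `L = 1 + log 2`, the quantities `(1 ∓ u)(L ± u)` bound `ρ_φ(t)` from
below up to the factor `π/2`, and `2 / L²` is the value at the equator `u = 0`. -/
theorem near_equator_algebra {u L : ℝ} (hu : 0 ≤ u) (hu' : u ≤ 0.4) (hL : 1.69 ≤ L)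
    (hL' : L ≤ 1.7) :
    1 / ((1 - u) * (L + u)) ^ 2 + 1 / ((1 + u) * (L - u)) ^ 2 ≤ 2 / L ^ 2 + 2 * u ^ 2 := by
  have h1 : 0 < (1 - u) * (L + u) := by apply mul_pos <;> linarith
  have h2 : 0 < (1 + u) * (L - u) := by apply mul_pos <;> linarith
  set v := u ^ 2 with hv
  set P := L ^ 2 with hP
  have hv0 : 0 ≤ v := by positivity
  have hv1 : v ≤ 0.16 := by rw [hv]; nlinarith
  have hP1 : 2.856 ≤ P := by rw [hP]; nlinarith
  have hP2 : P ≤ 2.89 := by rw [hP]; nlinarith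
  have hprod : P - 3.89 * v ≤ ((1 - u) * (L + u)) * ((1 + u) * (L - u)) := by
    have : ((1 - u) * (L + u)) * ((1 + u) * (L - u)) = (1 - v) * (P - v) := by
      rw [hv, hP]; ring
    rw [this]; nlinarith [mul_nonneg hv0 hv0]
  have hsum : ((1 - u) * (L + u)) ^ 2 + ((1 + u) * (L - u)) ^ 2 ≤ 2 * (P - 2.73 * v) := by
    have : ((1 - u) * (L + u)) ^ 2 + ((1 + u) * (L - u)) ^ 2
        = 2 * ((L - v) ^ 2 + (L - 1) ^ 2 * v) := by rw [hv]; ring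
    rw [this]
    have : (L - 1) ^ 2 * v ≤ 0.49 * v := by gcongr; nlinarith
    nlinarith
  have hD : 0 < P - 3.89 * v := by linarith
  have hkey : (P - 2.73 * v) * P ≤ (P - 3.89 * v) ^ 2 * (1 + v * P) := by
    have : 0 ≤ v * (P * (P ^ 2 - 5.05) + v * (15.1 - 7.78 * P ^ 2)) := by
      apply mul_nonneg hv0
      have h3 : 8.15 ≤ P ^ 2 := by nlinarith
      have h4 : P ^ 2 ≤ 8.36 := by nlinarith
      nlinarith
    nlinarith [mul_nonneg (mul_nonneg hv0 hv0) (mul_nonneg hv0 (by linarith : 0 ≤ P)),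
      mul_nonneg hv0 hv0]
  calc _ = (((1 - u) * (L + u)) ^ 2 + ((1 + u) * (L - u)) ^ 2)
        / (((1 - u) * (L + u)) * ((1 + u) * (L - u))) ^ 2 := by
        generalize (1 - u) * (L + u) = α at h1 ⊢
        generalize (1 + u) * (L - u) = β at h2 ⊢
        field_simp
        ring
    _ ≤ 2 * (P - 2.73 * v) / (P - 3.89 * v) ^ 2 := by
        have : 0 ≤ P - 2.73 * v := by linarith
        gcongr
    _ ≤ 2 / P + 2 * v := by
        rw [div_add' _ _ _ (by linarith), div_le_div_iff₀ (by positivity) (by linarith)]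
        linarith

theorem one_div_sub_one_div_add {s l : ℝ} (hs : 0 < s) (hl : 0 ≤ l) :
    1 / (2 * s) - 1 / (2 * (s + l)) = l / (2 * s * (s + l)) := by
  have : 0 < s + l := by linarith
  field_simp
  ring

/-- Here `s = ψ(π/2)`, `s + l = ψ(t)` and `k` stands for `1 / (π (1 + log 2))²`. -/
theorem far_from_equator_algebra {s l k : ℝ} (hs : 2.05 ≤ s) (hl : 0.18 ≤ l) (hk : 0.035 ≤ k) :
    1 / (4 * (s + l) ^ 2) < l / (2 * s * (s + l)) + k := by
  have hsl : 0 < s + l := by linarith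
  have hm : 0.09 / (s + l) ^ 2 ≤ l / (2 * s * (s + l)) := by
    rw [show l / (2 * s * (s + l)) = l * (s + l) / (2 * s) / (s + l) ^ 2 by field_simp]
    gcongr
    rw [le_div_iff₀ (by linarith)]
    nlinarith
  have hn : 1 / (4 * (s + l) ^ 2) = 0.09 / (s + l) ^ 2 + 0.16 / (s + l) ^ 2 := by
    field_simp; norm_num
  have ho : 0.16 / (s + l) ^ 2 < 0.035 := by
    rw [div_lt_iff₀ (by positivity)]
    nlinarith
  linarith

/-- The quadratic gain of the Hardy weight at the equator beats the loss `x² / (2 a⁴)` coming from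
`ρ_φ`, where `a = π/2`. -/
theorem near_equator_quadratic {x a s l : ℝ} (hx : 0 < x) (ha : 1.57 ≤ a) (hs : 2 ≤ s)
    (hs' : s ≤ 2.172) (hl : 0 ≤ l) (hl' : l ≤ 0.22) :
    x ^ 2 / (2 * a ^ 4) < x ^ 2 / (4 * (s + l) ^ 2) + x ^ 2 / (4 * s * (s + l)) := by
  have q1 : x ^ 2 / (2 * a ^ 4) < x ^ 2 / 12 := by
    have h2 : 2.46 ≤ a ^ 2 := by nlinarith
    have h4 : 6.05 ≤ a ^ 4 := by nlinarith
    gcongr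
    linarith
  have q2 : x ^ 2 / 23 ≤ x ^ 2 / (4 * (s + l) ^ 2) := by
    gcongr; nlinarith
  have q3 : x ^ 2 / 23 ≤ x ^ 2 / (4 * s * (s + l)) := by
    gcongr; nlinarith
  have : 0 < x ^ 2 := by positivity
  linarith

theorem inv_sq_add_inv_sq_lt {x a : ℝ} (hx : 0 < x) (ha : 1.57 ≤ a) (h : x ≤ a / 2) :
    1 / (a - x) ^ 2 + 1 / (a + x) ^ 2 < 2 * x ^ 2 + 2 / a ^ 2 := by
  have ha0 : 0 < a := by linarith
  obtain ⟨w, rfl⟩ : ∃ w, x = a * w := ⟨x / a, by field_simp⟩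
  have hw0 : 0 < w := pos_of_mul_pos_right hx ha0.le
  have hw1 : w ≤ 1 / 2 := by nlinarith
  have h1 : 0 < 1 - w := by linarith
  have hv1 : w ^ 2 ≤ 1 / 4 := by nlinarith
  have e1 : 1 / (a - a * w) ^ 2 + 1 / (a + a * w) ^ 2
      = 2 / a ^ 2 * ((1 + w ^ 2) / (1 - w ^ 2) ^ 2) := by
    rw [show a - a * w = a * (1 - w) by ring, show a + a * w = a * (1 + w) by ring,
      show 1 - w ^ 2 = (1 - w) * (1 + w) by ring]
    field_simp
    ring
  have e2 : (1 + w ^ 2) / (1 - w ^ 2) ^ 2 ≤ 1 + 6 * w ^ 2 := by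
    have : 0 < 1 - w ^ 2 := by linarith
    rw [div_le_iff₀ (by positivity)]
    have h0 : 0 ≤ w ^ 2 := by positivity
    generalize w ^ 2 = v at *
    have h3 : 0 ≤ v * (3 - 11 * v + 6 * v ^ 2) := mul_nonneg h0 (by nlinarith)
    nlinarith
  have e3 : 2 / a ^ 2 * (6 * w ^ 2) < 2 * (a * w) ^ 2 := by
    have h2 : 2.46 ≤ a ^ 2 := by nlinarith
    have h4 : 6.05 ≤ a ^ 2 * a ^ 2 := by nlinarith
    rw [div_mul_eq_mul_div, div_lt_iff₀ (by positivity)]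
    have : 0 < w ^ 2 := by positivity
    nlinarith
  calc _ = 2 / a ^ 2 * ((1 + w ^ 2) / (1 - w ^ 2) ^ 2) := e1
    _ ≤ 2 / a ^ 2 * (1 + 6 * w ^ 2) := by gcongr
    _ = 2 / a ^ 2 * (6 * w ^ 2) + 2 / a ^ 2 := by ring
    _ < _ := by linarith

/-- The Hardy weight `cos² t / (4 sin² t ψ(t)²) - 1 / (2 ψ(t))`, equal to `-Δw / w` for the positive
function `w = √ψ` of the geodesic distance `t` to the pole. -/
noncomputable def hardyWeight (t : ℝ) : ℝ :=
  Real.cos t ^ 2 / (4 * Real.sin t ^ 2 * psi t ^ 2) - 1 / (2 * psi t)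

theorem hardyWeight_pi_sub (t : ℝ) : hardyWeight (Real.pi - t) = hardyWeight t := by
  simp [hardyWeight, psi, Real.cos_pi_sub, Real.sin_pi_sub]

theorem neg_log_cos_le {x : ℝ} (h0 : 0 ≤ x) (h : x ≤ 0.6) : -Real.log (Real.cos x) ≤ 0.22 := by
  have h1 := Real.one_sub_sq_div_two_le_cos (x := x)
  have h2 : 0.82 ≤ Real.cos x := by nlinarith
  have h3 := Real.one_sub_inv_le_log_of_pos (x := Real.cos x) (by linarith)
  have h4 : (Real.cos x)⁻¹ ≤ (0.82)⁻¹ := by gcongr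
  norm_num at h4 ⊢
  linarith

/-- The strict pointwise inequality for `φ` at the two points at distance `x` from the equator. -/
theorem rho_phi_weight_lt_of_pos {x : ℝ} (h0 : 0 < x) (h1 : x < Real.pi / 2) :
    1 / 4 * (1 / rho phi (Real.pi / 2 - x) ^ 2 + 1 / rho phi (Real.pi / 2 + x) ^ 2)
      < hardyWeight (Real.pi / 2 - x) + constA / 4 := by
  have hpi := Real.pi_gt_d4
  have hpi' := Real.pi_lt_d4
  obtain ⟨hl1, hl2⟩ := log_pi_bounds
  have hc : 0 < Real.cos x := Real.cos_pos_of_mem_Ioo ⟨by linarith, h1⟩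
  set L := 1 + Real.log 2 with hL
  have hLl : 1.69 ≤ L := by linarith [Real.log_two_gt_d9]
  have hLu : L ≤ 1.6932 := by linarith [Real.log_two_lt_d9]
  set s0 := 1 + Real.log Real.pi with hs0
  have hcl := log_cos_le_neg_sq_half h0.le h1
  set l := -Real.log (Real.cos x) with hl
  have hlx : x ^ 2 / 2 ≤ l := by linarith
  have hpsi : psi (Real.pi / 2 - x) = s0 + l := by
    rw [psi, Real.sin_pi_div_two_sub, phi_eq hc]; ring
  have hH : hardyWeight (Real.pi / 2 - x)
      = Real.sin x ^ 2 / (4 * Real.cos x ^ 2 * (s0 + l) ^ 2) - 1 / (2 * (s0 + l)) := by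
    rw [hardyWeight, hpsi, Real.sin_pi_div_two_sub, Real.cos_pi_div_two_sub]
  have hA : constA / 4 = 1 / (2 * s0) + 2 / (Real.pi ^ 2 * L ^ 2) := by
    have hs0p : 0 < s0 := by linarith
    rw [constA, ← hs0, ← hL]
    field_simp
    ring
  have hlog2 : rho phi (Real.pi / 2) = Real.pi / 2 * L := by
    rw [rho, phi_eq (by positivity), Real.log_div Real.pi_ne_zero (by norm_num), hL]; ring
  have hl0 : 0 ≤ l := le_trans (by positivity) hlx
  rw [hH, hA]
  have hs0' : 2.05 ≤ s0 := by linarith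
  have hdiff := one_div_sub_one_div_add (s := s0) (by linarith) hl0
  have hsl : 0 < s0 + l := by linarith
  rcases le_total 0.6 x with hx | hx
  · -- Far from the equator: `ρ_φ` increases, so `ρ_φ(t) ≥ ρ_φ(sin t) = sin t ψ(t)` controls the
    -- singular term, and the other one is at most its value at the equator.
    have hl18 : 0.18 ≤ l := by nlinarith only [hx, hlx]
    have e1 : 1 / rho phi (Real.pi / 2 - x) ^ 2 ≤ 1 / (Real.cos x * (s0 + l)) ^ 2 := by
      have h : rho phi (Real.cos x) ≤ rho phi (Real.pi / 2 - x) := by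
        refine rho_phi_mono hc ?_ (by linarith)
        rw [← Real.sin_pi_div_two_sub]
        exact Real.sin_le (by linarith)
      have h' : rho phi (Real.cos x) = Real.cos x * (s0 + l) := by
        rw [rho, phi_eq hc]; ring
      rw [h'] at h
      gcongr
    have e2 : 1 / rho phi (Real.pi / 2 + x) ^ 2 ≤ 1 / (Real.pi / 2 * L) ^ 2 := by
      rw [← hlog2]
      have h := rho_phi_mono (s := Real.pi / 2) (t := Real.pi / 2 + x) (by linarith)
        (by linarith) (by linarith)
      have : 0 < rho phi (Real.pi / 2) := by rw [hlog2]; positivity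
      gcongr
    have e3 : Real.sin x ^ 2 / (4 * Real.cos x ^ 2 * (s0 + l) ^ 2)
        = 1 / 4 * (1 / (Real.cos x * (s0 + l)) ^ 2) - 1 / (4 * (s0 + l) ^ 2) := by
      rw [Real.sin_sq]; field_simp
    have e4 : 1 / 4 * (1 / (Real.pi / 2 * L) ^ 2) = 1 / (Real.pi ^ 2 * L ^ 2) := by
      field_simp; norm_num
    have e5 : 1 / (4 * (s0 + l) ^ 2) < l / (2 * s0 * (s0 + l)) + 1 / (Real.pi ^ 2 * L ^ 2) := by
      refine far_from_equator_algebra hs0' hl18 ?_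
      rw [le_div_iff₀ (by positivity)]
      have h1 : Real.pi ^ 2 ≤ 9.87 := by nlinarith only [hpi, hpi']
      have h2 : L ^ 2 ≤ 2.867 := by nlinarith only [hLl, hLu]
      have h3 := mul_le_mul h1 h2 (by positivity) (by norm_num)
      linarith only [h3]
    have e6 : 2 / (Real.pi ^ 2 * L ^ 2) = 2 * (1 / (Real.pi ^ 2 * L ^ 2)) := by ring
    linarith
  · -- Near the equator: both sides agree at `x = 0`, so the second order terms are compared, with
    -- `log (1 ± u) ≤ ±u` used to bound `ρ_φ` from below.
    have hl22 := neg_log_cos_le h0.le hx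
    set a := Real.pi / 2 with ha
    have ha0 : 0 < a := by linarith
    set u := x / a with hu
    have hxu : x = a * u := by rw [hu]; field_simp
    have hu0 : 0 < u := by positivity
    have hu4 : u ≤ 0.4 := by rw [hu, div_le_iff₀ (by positivity)]; linarith
    have r1 : a * ((1 - u) * (L + u)) ≤ rho phi (a - x) := by
      have : a - x = a * (1 - u) := by rw [hxu]; ring
      rw [this, rho, phi_eq (by apply mul_pos <;> linarith),
        Real.log_mul (by linarith) (by linarith), ha,
        Real.log_div Real.pi_ne_zero (by norm_num), mul_assoc]
      have := Real.log_le_sub_one_of_pos (x := 1 - u) (by linarith)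
      refine mul_le_mul_of_nonneg_left (mul_le_mul_of_nonneg_left ?_ ?_) ha0.le <;> linarith
    have r2 : a * ((1 + u) * (L - u)) ≤ rho phi (a + x) := by
      have : a + x = a * (1 + u) := by rw [hxu]; ring
      rw [this, rho, phi_eq (by apply mul_pos <;> linarith),
        Real.log_mul (by linarith) (by linarith), ha,
        Real.log_div Real.pi_ne_zero (by norm_num), mul_assoc]
      have := Real.log_le_sub_one_of_pos (x := 1 + u) (by linarith)
      refine mul_le_mul_of_nonneg_left (mul_le_mul_of_nonneg_left ?_ ?_) ha0.le <;> linarith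
    have p1 : 0 < (1 - u) * (L + u) := by apply mul_pos <;> linarith
    have p2 : 0 < (1 + u) * (L - u) := by apply mul_pos <;> linarith
    have e1 : 1 / rho phi (a - x) ^ 2 + 1 / rho phi (a + x) ^ 2
        ≤ 1 / a ^ 2 * (2 / L ^ 2 + 2 * u ^ 2) := by
      calc _ ≤ 1 / (a * ((1 - u) * (L + u))) ^ 2 + 1 / (a * ((1 + u) * (L - u))) ^ 2 := by
            gcongr
        _ = 1 / a ^ 2 * (1 / ((1 - u) * (L + u)) ^ 2 + 1 / ((1 + u) * (L - u)) ^ 2) := by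
            field_simp
        _ ≤ _ := mul_le_mul_of_nonneg_left
            (near_equator_algebra hu0.le hu4 hLl (by linarith)) (by positivity)
    have e2 : 1 / 4 * (1 / a ^ 2 * (2 / L ^ 2 + 2 * u ^ 2))
        = 2 / (Real.pi ^ 2 * L ^ 2) + x ^ 2 / (2 * a ^ 4) := by
      rw [hu, show Real.pi = 2 * a by rw [ha]; ring]
      field_simp
      ring
    have e3 : x ^ 2 / (4 * (s0 + l) ^ 2)
        ≤ Real.sin x ^ 2 / (4 * Real.cos x ^ 2 * (s0 + l) ^ 2) := by
      have ht := Real.lt_tan h0 h1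
      have : Real.sin x ^ 2 / (4 * Real.cos x ^ 2 * (s0 + l) ^ 2)
          = Real.tan x ^ 2 / (4 * (s0 + l) ^ 2) := by
        rw [Real.tan_eq_sin_div_cos]; field_simp
      rw [this]
      gcongr
    have e4 : x ^ 2 / (4 * s0 * (s0 + l)) ≤ l / (2 * s0 * (s0 + l)) := by
      rw [div_le_div_iff₀ (by positivity) (by positivity)]
      have : 0 ≤ s0 * (s0 + l) := by positivity
      nlinarith only [mul_le_mul_of_nonneg_right hlx this]
    have e5 := near_equator_quadratic (a := a) h0 (by linarith) (by linarith : 2 ≤ s0)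
      (by linarith) hl0 hl22
    linarith

/-- The strict pointwise inequality for `ψ` at the two points at distance `x` from the equator. -/
theorem rho_psi_weight_lt_of_pos {x : ℝ} (h0 : 0 < x) (h1 : x < Real.pi / 2) :
    1 / 4 * (1 / rho psi (Real.pi / 2 - x) ^ 2 + 1 / rho psi (Real.pi / 2 + x) ^ 2)
      < hardyWeight (Real.pi / 2 - x) + constB / 4 := by
  have hpi := Real.pi_gt_d4
  have hpi' := Real.pi_lt_d4
  obtain ⟨hl1, hl2⟩ := log_pi_bounds
  have hc : 0 < Real.cos x := Real.cos_pos_of_mem_Ioo ⟨by linarith, h1⟩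
  set s0 := 1 + Real.log Real.pi with hs0
  have hcl := log_cos_le_neg_sq_half h0.le h1
  set l := -Real.log (Real.cos x) with hl
  have hlx : x ^ 2 / 2 ≤ l := by linarith
  have hl0 : 0 < l := lt_of_lt_of_le (by positivity) hlx
  have hpsi : psi (Real.pi / 2 - x) = s0 + l := by
    rw [psi, Real.sin_pi_div_two_sub, phi_eq hc]; ring
  have hpsi' : psi (Real.pi / 2 + x) = s0 + l := by
    rw [psi, add_comm, Real.sin_add_pi_div_two, phi_eq hc]; ring
  set a := Real.pi / 2 with ha
  have hH : hardyWeight (a - x)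
      = Real.tan x ^ 2 / (4 * (s0 + l) ^ 2) - 1 / (2 * (s0 + l)) := by
    rw [hardyWeight, hpsi, ha, Real.sin_pi_div_two_sub, Real.cos_pi_div_two_sub,
      Real.tan_eq_sin_div_cos]
    field_simp
  have hs0' : 2.05 ≤ s0 := by linarith
  have hsl : 0 < s0 + l := by linarith
  have hs0p : 0 < s0 := by linarith
  have ha0 : 0 < a := by linarith
  have hB : constB / 4 = 1 / (2 * s0) + 1 / (4 * s0 ^ 2) * (2 / a ^ 2) := by
    rw [constB, ← hs0, show Real.pi = 2 * a by rw [ha]; ring]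
    field_simp
    ring
  rw [hH, hB, rho, rho, hpsi, hpsi']
  have ht := Real.lt_tan h0 h1
  have hax : 0 < a - x := by linarith
  -- Multiplying by `4 ψ²`, the claim reduces to this bound.
  have key : 1 / (a - x) ^ 2 + 1 / (a + x) ^ 2 < Real.tan x ^ 2 + 2 * l + 2 / a ^ 2 := by
    rcases le_total x (Real.pi / 4) with hx | hx
    · have e1 := inv_sq_add_inv_sq_lt (a := a) h0 (by linarith) (by linarith)
      have e4 : x ^ 2 < Real.tan x ^ 2 := by gcongr
      linarith
    · have e1 : 1 / (a - x) ^ 2 ≤ 1 / Real.cos x ^ 2 := by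
        have : Real.cos x ≤ a - x := by
          rw [← Real.sin_pi_div_two_sub]; exact Real.sin_le hax.le
        gcongr
      have e2 : 1 / Real.cos x ^ 2 = 1 + Real.tan x ^ 2 := by
        rw [Real.tan_eq_sin_div_cos]; field_simp; linarith [Real.sin_sq_add_cos_sq x]
      have e3 : 1 / (a + x) ^ 2 ≤ 0.19 := by
        rw [div_le_iff₀ (by positivity)]; nlinarith
      have e4 : 0.8 ≤ 2 / a ^ 2 := by
        rw [le_div_iff₀ (by positivity)]; nlinarith
      have e5 : 0.6 ≤ 2 * l := by nlinarith
      linarith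
  have m1 : 1 / 4 * (1 / ((a - x) * (s0 + l)) ^ 2 + 1 / ((a + x) * (s0 + l)) ^ 2)
      = 1 / (4 * (s0 + l) ^ 2) * (1 / (a - x) ^ 2 + 1 / (a + x) ^ 2) := by field_simp
  have m2 : 1 / (4 * (s0 + l) ^ 2) * (1 / (a - x) ^ 2 + 1 / (a + x) ^ 2)
      < 1 / (4 * (s0 + l) ^ 2) * (Real.tan x ^ 2 + 2 * l + 2 / a ^ 2) := by gcongr
  have m3 := one_div_sub_one_div_add hs0p hl0.le
  have m4 : 1 / (4 * (s0 + l) ^ 2) * (2 * l) ≤ l / (2 * s0 * (s0 + l)) := by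
    rw [show 1 / (4 * (s0 + l) ^ 2) * (2 * l) = l / (2 * (s0 + l) * (s0 + l)) by field_simp; ring]
    gcongr
    linarith
  have m5 : 1 / (4 * (s0 + l) ^ 2) * (2 / a ^ 2) ≤ 1 / (4 * s0 ^ 2) * (2 / a ^ 2) := by
    gcongr
    linarith
  have m6 : 1 / (4 * (s0 + l) ^ 2) * (Real.tan x ^ 2 + 2 * l + 2 / a ^ 2)
    = Real.tan x ^ 2 / (4 * (s0 + l) ^ 2) + 1 / (4 * (s0 + l) ^ 2) * (2 * l)
      + 1 / (4 * (s0 + l) ^ 2) * (2 / a ^ 2) := by ring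
  linarith

theorem weight_lt_of_pos {η : ℝ → ℝ} {C : ℝ}
    (h : ∀ x, 0 < x → x < Real.pi / 2 →
      1 / 4 * (1 / rho η (Real.pi / 2 - x) ^ 2 + 1 / rho η (Real.pi / 2 + x) ^ 2)
        < hardyWeight (Real.pi / 2 - x) + C / 4)
    {t : ℝ} (h0 : 0 < t) (h1 : t < Real.pi) (h2 : t ≠ Real.pi / 2) :
    1 / 4 * (1 / rho η t ^ 2 + 1 / rho η (Real.pi - t) ^ 2) < hardyWeight t + C / 4 := by
  rcases lt_or_gt_of_ne h2 with h3 | h3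
  · have := h (Real.pi / 2 - t) (by linarith) (by linarith)
    rwa [sub_sub_cancel, show Real.pi / 2 + (Real.pi / 2 - t) = Real.pi - t by ring] at this
  · have := h (t - Real.pi / 2) (by linarith) (by linarith)
    rw [show Real.pi / 2 - (t - Real.pi / 2) = Real.pi - t by ring, add_sub_cancel,
      hardyWeight_pi_sub] at this
    linarith

theorem rho_phi_weight_lt {t : ℝ} (h0 : 0 < t) (h1 : t < Real.pi) (h2 : t ≠ Real.pi / 2) :
    1 / 4 * (1 / rho phi t ^ 2 + 1 / rho phi (Real.pi - t) ^ 2) < hardyWeight t + constA / 4 :=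
  weight_lt_of_pos (fun _ => rho_phi_weight_lt_of_pos) h0 h1 h2

theorem rho_psi_weight_lt {t : ℝ} (h0 : 0 < t) (h1 : t < Real.pi) (h2 : t ≠ Real.pi / 2) :
    1 / 4 * (1 / rho psi t ^ 2 + 1 / rho psi (Real.pi - t) ^ 2) < hardyWeight t + constB / 4 :=
  weight_lt_of_pos (fun _ => rho_psi_weight_lt_of_pos) h0 h1 h2

open scoped RealInnerProductSpace

/-! ### Radial extension and the surface gradient -/

theorem radialProj_coe {y : E3} (hy : y ≠ 0) : (radialProj y : E3) = ‖y‖⁻¹ • y := by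
  simp [radialProj, hy]

theorem radialProj_self (x : S2) : radialProj (x : E3) = x := by
  apply Subtype.ext
  have hx : ‖(x : E3)‖ = 1 := norm_eq_of_mem_sphere x
  rw [radialProj_coe (ne_zero_of_mem_unit_sphere x), hx, inv_one, one_smul]

theorem radialProj_smul {r : ℝ} (hr : 0 < r) (y : E3) : radialProj (r • y) = radialProj y := by
  rcases eq_or_ne y 0 with rfl | hy
  · simp
  · apply Subtype.ext
    rw [radialProj_coe hy, radialProj_coe (smul_ne_zero hr.ne' hy), norm_smul, Real.norm_eq_abs,
      abs_of_pos hr, smul_smul]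
    congr 1
    field_simp

theorem contMDiffAt_radialProj {y : E3} (hy : y ≠ 0) :
    ContMDiffAt 𝓘(ℝ, E3) (𝓡 2) ∞ radialProj y := by
  let U : TopologicalSpace.Opens E3 := ⟨{0}ᶜ, isOpen_compl_singleton⟩
  have h0 : ∀ z : U, (z : E3) ≠ 0 := fun z => z.2
  have hsm : ContMDiff 𝓘(ℝ, E3) 𝓘(ℝ, E3) ∞ (fun z : U => ‖(z : E3)‖⁻¹ • (z : E3)) := by
    intro z
    refine (contMDiffAt_subtype_iff (U := U) (x := z)
      (f := fun w : E3 => ‖w‖⁻¹ • w)).2 ?_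
    exact ((((contDiffAt_id).norm ℝ (h0 z)).inv (norm_ne_zero_iff.2 (h0 z))).smul
      contDiffAt_id).contMDiffAt
  have hmem : ∀ z : U, ‖(z : E3)‖⁻¹ • (z : E3) ∈ sphere (0 : E3) 1 := by
    intro z
    rw [← radialProj_coe (h0 z)]
    exact (radialProj _).2
  have : Fact (Module.finrank ℝ E3 = 2 + 1) := ⟨finrank_euclideanSpace_fin⟩
  have h := hsm.codRestrict_sphere (n := 2) hmem
  have h' : (Set.codRestrict _ _ hmem : U → S2) = fun z : U => radialProj z := by
    funext z
    apply Subtype.ext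
    rw [radialProj_coe (h0 z)]
    rfl
  rw [h'] at h
  exact (contMDiffAt_subtype_iff (U := U) (x := ⟨y, hy⟩) (f := radialProj)).1 (h ⟨y, hy⟩)

theorem SmoothOnS2.contDiffAt_radial {u : S2 → ℝ} (hu : SmoothOnS2 u) {y : E3} (hy : y ≠ 0) :
    ContDiffAt ℝ ∞ (fun y => u (radialProj y)) y := by
  have h : ContMDiffAt 𝓘(ℝ, E3) 𝓘(ℝ, ℝ) ∞ (u ∘ radialProj) y :=
    ContMDiffAt.comp y (hu (radialProj y)) (contMDiffAt_radialProj hy)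
  exact contMDiffAt_iff_contDiffAt.1 h

theorem SmoothOnS2.continuous {u : S2 → ℝ} (hu : SmoothOnS2 u) : Continuous u :=
  ContMDiff.continuous hu

theorem SmoothOnS2.continuous_surfGrad {u : S2 → ℝ} (hu : SmoothOnS2 u) :
    Continuous (surfGrad u) := by
  rw [continuous_iff_continuousAt]
  intro x
  have h := (hu.contDiffAt_radial (ne_zero_of_mem_unit_sphere x)).fderiv_right (m := 0)
    (by norm_num)
  have h2 : ContinuousAt (gradient (fun y : E3 => u (radialProj y))) (x : E3) :=
    (InnerProductSpace.toDual ℝ E3).symm.continuous.continuousAt.comp h.continuousAt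
  exact ContinuousAt.comp (f := Subtype.val) h2 continuous_subtype_val.continuousAt

theorem inner_surfGrad (u : S2 → ℝ) (x : S2) (v : E3) :
    ⟪surfGrad u x, v⟫ = fderiv ℝ (fun y : E3 => u (radialProj y)) x v := by
  rw [surfGrad, inner_gradient_left]

/-- The derivative of an extension constant on rays is homogeneous of degree `-1`. -/
theorem SmoothOnS2.fderiv_radial_smul {u : S2 → ℝ} (hu : SmoothOnS2 u) (x : S2) {r : ℝ}
    (hr : 0 < r) (v : E3) :
    fderiv ℝ (fun y : E3 => u (radialProj y)) (r • (x : E3)) v = r⁻¹ * ⟪surfGrad u x, v⟫ := by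
  have h1 : (fun y : E3 => u (radialProj y)) = fun y => u (radialProj (r⁻¹ • y)) := by
    funext y; rw [radialProj_smul (inv_pos.2 hr)]
  have h2 : HasFDerivAt (fun y : E3 => u (radialProj y))
      (fderiv ℝ (fun y : E3 => u (radialProj y)) (x : E3)) (r⁻¹ • (r • (x : E3))) := by
    rw [inv_smul_smul₀ hr.ne']
    exact ((hu.contDiffAt_radial (ne_zero_of_mem_unit_sphere x)).differentiableAt
      (by norm_num)).hasFDerivAt
  have h3 := h2.comp (r • (x : E3)) ((hasFDerivAt_id (𝕜 := ℝ) (r • (x : E3))).const_smul r⁻¹)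
  have h4 : HasFDerivAt (fun y : E3 => u (radialProj y)) _ (r • (x : E3)) :=
    h3.congr_of_eventuallyEq (Filter.Eventually.of_forall fun y => by
      simp [radialProj_smul (inv_pos.2 hr)])
  rw [h4.fderiv, inner_surfGrad]
  simp

/-! ### The divergence theorem for the meridian field -/

/-- The field `y ↦ ‖y‖² p - ⟪y, p⟫ y` on `ℝ³` has divergence `-2 ⟪y, p⟫`. -/
theorem integral_fderiv_apply_meridian (p : E3) {Φ : E3 → ℝ} (hΦ : ContDiff ℝ 1 Φ)
    (hc : HasCompactSupport Φ) :
    ∫ y, fderiv ℝ Φ y (‖y‖ ^ 2 • p - ⟪y, p⟫ • y) = ∫ y, 2 * ⟪y, p⟫ * Φ y := by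
  let e : Fin 3 → E3 := fun i => EuclideanSpace.single i 1
  let X : Fin 3 → E3 → ℝ := fun i y => ‖y‖ ^ 2 * p i - ⟪y, p⟫ * y i
  have hX : ∀ i, ContDiff ℝ 1 (X i) := fun i => by
    have h1 : ContDiff ℝ 1 fun y : E3 => y i := by fun_prop
    have h2 : ContDiff ℝ 1 fun y : E3 => ⟪y, p⟫ := contDiff_id.inner ℝ contDiff_const
    exact ((contDiff_norm_sq ℝ).mul contDiff_const).sub (h2.mul h1)
  have hXd : ∀ i y, fderiv ℝ (X i) y (e i) = y i * p i - ⟪y, p⟫ := fun i y => by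
    have h1 : HasFDerivAt (fun y : E3 => y i) (EuclideanSpace.proj (𝕜 := ℝ) i : E3 →L[ℝ] ℝ) y :=
      (EuclideanSpace.proj (𝕜 := ℝ) i : E3 →L[ℝ] ℝ).hasFDerivAt
    have h2 : HasFDerivAt (fun y : E3 => ⟪y, p⟫) (innerSL ℝ p : E3 →L[ℝ] ℝ) y := by
      simp_rw [real_inner_comm p]
      exact (innerSL ℝ p : E3 →L[ℝ] ℝ).hasFDerivAt
    have h3 : HasFDerivAt (fun y : E3 => ‖y‖ ^ 2) (2 • (innerSL ℝ y)) y :=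
      (hasStrictFDerivAt_norm_sq y).hasFDerivAt
    have h4 := (h3.mul_const (p i)).sub (h2.mul h1)
    have h5 : fderiv ℝ (X i) y = _ := h4.fderiv
    rw [h5]
    simp [e, EuclideanSpace.inner_single_right, innerSL_apply_apply]
    ring
  have hDΦ : ∀ i, Continuous fun y => fderiv ℝ Φ y (e i) := fun i =>
    (hΦ.continuous_fderiv (by norm_num)).clm_apply continuous_const
  have hcD : ∀ i, HasCompactSupport fun y => fderiv ℝ Φ y (e i) := fun i =>
    hc.fderiv_apply ℝ (e i)
  have hi1 : ∀ i, Integrable fun y => X i y * fderiv ℝ Φ y (e i) := fun i =>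
    ((hX i).continuous.mul (hDΦ i)).integrable_of_hasCompactSupport (hcD i).mul_left
  have hi2 : ∀ i, Integrable fun y => fderiv ℝ (X i) y (e i) * Φ y := fun i =>
    ((((hX i).continuous_fderiv (by norm_num)).clm_apply continuous_const).mul
      hΦ.continuous).integrable_of_hasCompactSupport hc.mul_left
  have hi3 : ∀ i, Integrable fun y => X i y * Φ y := fun i =>
    ((hX i).continuous.mul hΦ.continuous).integrable_of_hasCompactSupport hc.mul_left
  have key : ∀ i, ∫ y, X i y * fderiv ℝ Φ y (e i) = - ∫ y, fderiv ℝ (X i) y (e i) * Φ y :=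
    fun i => integral_mul_fderiv_eq_neg_fderiv_mul_of_integrable (hi2 i) (hi1 i) (hi3 i)
      (fun y _ => ((hX i).differentiable (by norm_num)) y)
      (fun y _ => (hΦ.differentiable (by norm_num)) y)
  have hl : ∀ y, fderiv ℝ Φ y (‖y‖ ^ 2 • p - ⟪y, p⟫ • y)
      = ∑ i, X i y * fderiv ℝ Φ y (e i) := fun y => by
    have : ‖y‖ ^ 2 • p - ⟪y, p⟫ • y = ∑ i, X i y • e i := by
      ext j
      simp [X, e, Pi.single_apply]
    rw [this, map_sum]
    simp
  have hr : ∀ y, 2 * ⟪y, p⟫ * Φ y = - ∑ i, fderiv ℝ (X i) y (e i) * Φ y := fun y => by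
    rw [← Finset.sum_mul]
    simp only [hXd, Finset.sum_sub_distrib]
    have : ⟪y, p⟫ = ∑ i, y i * p i := by
      simp [PiLp.inner_apply, mul_comm]
    rw [← this]
    simp
    ring
  simp_rw [hl, hr]
  rw [integral_finsetSum _ fun i _ => hi1 i, integral_neg, integral_finsetSum _ fun i _ => hi2 i,
    ← Finset.sum_neg_distrib]
  exact Finset.sum_congr rfl fun i _ => key i

/-- Integration in polar coordinates of a product of a radial and an angular function. -/
theorem integral_radial_mul_angular (a : ℝ → ℝ) (K : S2 → ℝ) :
    ∫ y : E3, a ‖y‖ * K (radialProj y)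
      = (∫ x, K x ∂surf) * ∫ r : Set.Ioi (0 : ℝ), a r ∂Measure.volumeIoiPow 2 := by
  calc _ = ∫ y : ({(0)}ᶜ : Set E3), a ‖y.1‖ * K (radialProj y.1)
        ∂((volume : Measure E3).comap (↑)) := by
        rw [integral_subtype_comap (measurableSet_singleton _).compl
          fun y : E3 => a ‖y‖ * K (radialProj y), restrict_compl_singleton]
    _ = ∫ w : S2 × Set.Ioi (0 : ℝ), K w.1 * a w.2 ∂(surf.prod (Measure.volumeIoiPow 2)) := by
        have h := (volume : Measure E3).measurePreserving_homeomorphUnitSphereProd.integral_comp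
          (Homeomorph.measurableEmbedding _)
          (fun w : S2 × Set.Ioi (0 : ℝ) => K w.1 * a w.2)
        rw [finrank_euclideanSpace_fin] at h
        rw [← h]
        refine integral_congr_ae (Filter.Eventually.of_forall fun y => ?_)
        have hp : radialProj y.1 = (homeomorphUnitSphereProd E3 y).1 := by
          apply Subtype.ext
          rw [radialProj_coe y.2]
          simp
        simp only [hp]
        simp [mul_comm]
    _ = _ := integral_prod_mul (μ := surf) (ν := Measure.volumeIoiPow 2) K
        (fun r : Set.Ioi (0 : ℝ) => a r)

/-- The divergence theorem on `𝕊²` for the field `p - ⟪x, p⟫ x`, whose surface divergence is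
`-2 ⟪x, p⟫`. It follows from the flat case applied to the extension constant on rays, cut off
radially. -/
theorem integral_inner_surfGrad_meridian (p : E3) {G : S2 → ℝ} (hG : SmoothOnS2 G) :
    ∫ x : S2, (⟪surfGrad G x, p - ⟪(x : E3), p⟫ • (x : E3)⟫ - 2 * ⟪(x : E3), p⟫ * G x) ∂surf
      = 0 := by
  -- `h(‖y‖²)` is smooth on `ℝ³` and vanishes near the origin, where `G ∘ radialProj` is singular.
  let h : ContDiffBump (2 : ℝ) := ⟨1 / 2, 1, by norm_num, by norm_num⟩
  have hout : ∀ y : E3, ‖y‖ ^ 2 < 1 → h (‖y‖ ^ 2) = 0 := fun y hy => by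
    apply h.zero_of_le_dist
    rw [Real.dist_eq, abs_of_neg (by linarith)]
    show (1 : ℝ) ≤ _
    linarith
  have hcut : ContDiff ℝ ∞ fun y : E3 => h (‖y‖ ^ 2) := h.contDiff.comp (contDiff_norm_sq ℝ)
  let Φ : E3 → ℝ := fun y => h (‖y‖ ^ 2) * G (radialProj y)
  have hsupp : HasCompactSupport fun y : E3 => h (‖y‖ ^ 2) := by
    refine HasCompactSupport.of_support_subset_isCompact (isCompact_closedBall (0 : E3) 2) ?_
    intro y hy
    by_contra hcon
    apply hy
    apply h.zero_of_le_dist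
    rw [mem_closedBall_zero_iff, not_le] at hcon
    have : 4 < ‖y‖ ^ 2 := by nlinarith
    rw [Real.dist_eq, abs_of_pos (by linarith)]
    show (1 : ℝ) ≤ _
    linarith
  have hΦ : ContDiff ℝ 1 Φ := by
    rw [contDiff_iff_contDiffAt]
    intro y
    by_cases hy : ‖y‖ ^ 2 < 1
    · have : Φ =ᶠ[nhds y] fun _ => 0 := by
        have ho : IsOpen {y : E3 | ‖y‖ ^ 2 < 1} :=
          isOpen_lt (by fun_prop) continuous_const
        filter_upwards [ho.mem_nhds hy] with w hw
        simp only [Φ, hout w hw, zero_mul]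
      exact contDiffAt_const.congr_of_eventuallyEq this
    · have hy0 : y ≠ 0 := by rintro rfl; simp at hy
      exact (hcut.contDiffAt.mul (hG.contDiffAt_radial hy0)).of_le (by norm_num)
  have hΦc : HasCompactSupport Φ := hsupp.mul_right
  have key := integral_fderiv_apply_meridian p hΦ hΦc
  let K : S2 → ℝ := fun x => ⟪surfGrad G x, p - ⟪(x : E3), p⟫ • (x : E3)⟫
    - 2 * ⟪(x : E3), p⟫ * G x
  let a : ℝ → ℝ := fun r => h (r ^ 2) * r
  have hpt : ∀ y : E3, fderiv ℝ Φ y (‖y‖ ^ 2 • p - ⟪y, p⟫ • y) - 2 * ⟪y, p⟫ * Φ y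
      = a ‖y‖ * K (radialProj y) := by
    intro y
    rcases eq_or_ne y 0 with rfl | hy
    · simp [a]
    have hr : 0 < ‖y‖ := norm_pos_iff.2 hy
    set r := ‖y‖ with hrdef
    set x := radialProj y with hx
    have hyx : y = r • (x : E3) := by
      rw [hx, radialProj_coe hy, ← hrdef, smul_inv_smul₀ hr.ne']
    have hd1 : HasFDerivAt (fun y : E3 => h (‖y‖ ^ 2))
        (deriv h (‖y‖ ^ 2) • (2 • (innerSL ℝ y))) y := by
      have hh : HasDerivAt h (deriv h (‖y‖ ^ 2)) (‖y‖ ^ 2) :=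
        (h.contDiff (n := 1)).differentiable (by norm_num) |>.differentiableAt.hasDerivAt
      exact HasDerivAt.comp_hasFDerivAt (h₂ := (h : ℝ → ℝ)) (f := fun y : E3 => ‖y‖ ^ 2) y hh
        (hasStrictFDerivAt_norm_sq y).hasFDerivAt
    have hd2 := ((hG.contDiffAt_radial hy).differentiableAt (by norm_num)).hasFDerivAt
    have hd : fderiv ℝ Φ y = _ := (hd1.mul hd2).fderiv
    -- The field is tangent to spheres, so the cut-off is not differentiated.
    have horth : ⟪y, r ^ 2 • p - ⟪y, p⟫ • y⟫ = 0 := by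
      rw [inner_sub_right, inner_smul_right, inner_smul_right, real_inner_self_eq_norm_sq,
        ← hrdef]
      ring
    have hvec : r ^ 2 • p - ⟪y, p⟫ • y = r ^ 2 • (p - ⟪(x : E3), p⟫ • (x : E3)) := by
      rw [hyx, inner_smul_left, smul_sub, smul_smul, smul_smul]
      congr 2
      simp; ring
    have hgr := hG.fderiv_radial_smul x hr (r ^ 2 • p - ⟪y, p⟫ • y)
    rw [← hyx] at hgr
    rw [hd]
    simp only [add_apply, smul_apply, innerSL_apply_apply,
      horth, hgr, smul_zero, mul_zero, add_zero, smul_eq_mul]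
    rw [hvec, inner_smul_right]
    have hyp : ⟪y, p⟫ = r * ⟪(x : E3), p⟫ := by
      conv_lhs => rw [hyx]
      rw [inner_smul_left]; simp
    rw [hyp]
    simp only [Φ, a, K, ← hrdef, ← hx]
    field_simp
  have hint1 : Integrable fun y => fderiv ℝ Φ y (‖y‖ ^ 2 • p - ⟪y, p⟫ • y) := by
    refine Continuous.integrable_of_hasCompactSupport ?_ ?_
    · exact (hΦ.continuous_fderiv (by norm_num)).clm_apply (by fun_prop)
    · refine (hΦc.fderiv (𝕜 := ℝ)).mono fun y hy hy' => hy ?_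
      simp only [hy', zero_apply]
  have hint2 : Integrable fun y : E3 => 2 * ⟪y, p⟫ * Φ y := by
    refine Continuous.integrable_of_hasCompactSupport ?_ hΦc.mul_left
    exact Continuous.mul (by fun_prop) hΦ.continuous
  have hzero : ∫ y : E3, a ‖y‖ * K (radialProj y) = 0 := by
    simp_rw [← hpt]
    rw [integral_sub hint1 hint2, key, sub_self]
  rw [integral_radial_mul_angular] at hzero
  refine (mul_eq_zero.1 hzero).resolve_right fun hrad => ?_
  -- The radial factor is nonzero because the cut-off has positive integral on `ℝ³`.
  have hone := integral_radial_mul_angular a fun _ => 1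
  rw [hrad, mul_zero] at hone
  simp only [mul_one] at hone
  have hcont : Continuous fun y : E3 => a ‖y‖ :=
    (hcut.continuous).mul continuous_norm
  have hpos : 0 < ∫ y : E3, a ‖y‖ := by
    refine hcont.integral_pos_of_hasCompactSupport_nonneg_nonzero hsupp.mul_right
      (fun y => mul_nonneg h.nonneg (norm_nonneg y))
      (x := EuclideanSpace.single 0 (Real.sqrt 2)) ?_
    simp only [a, PiLp.norm_single, Real.norm_eq_abs, sq_abs]
    rw [Real.sq_sqrt (by norm_num), h.one_of_mem_closedBall (by simp; norm_num)]
    positivity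
  exact hpos.ne' hone

open Filter Topology

/-! ### Hardy's inequality for a general meridian field -/

/-- The height `⟪x, p⟫` of `x` above the equator relative to the pole `p`; it is the cosine of the
geodesic distance from `x` to `p`. -/
noncomputable def height (p x : S2) : ℝ := ⟪(x : E3), (p : E3)⟫

theorem continuous_height (p : S2) : Continuous (height p) :=
  continuous_subtype_val.inner continuous_const

theorem abs_height_le_one (p x : S2) : |height p x| ≤ 1 := by
  have h := abs_real_inner_le_norm (x : E3) (p : E3)
  rwa [norm_eq_of_mem_sphere x, norm_eq_of_mem_sphere p, one_mul] at h

theorem height_sq_le_one (p x : S2) : height p x ^ 2 ≤ 1 :=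
  (sq_le_one_iff_abs_le_one _).2 (abs_height_le_one p x)

theorem smoothOnS2_height (p : S2) : SmoothOnS2 (height p) := by
  have : Fact (Module.finrank ℝ E3 = 2 + 1) := ⟨finrank_euclideanSpace_fin⟩
  have h1 : ContMDiff (𝓡 2) 𝓘(ℝ, E3) ∞ ((↑) : S2 → E3) := contMDiff_coe_sphere
  have h2 : ContDiff ℝ ∞ fun y : E3 => ⟪y, (p : E3)⟫ := contDiff_id.inner ℝ contDiff_const
  exact h2.contMDiff.comp h1

/-- The field `p - ⟪x, p⟫ x` is tangent to `𝕊²` and is the surface gradient of the height. -/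
noncomputable def meridian (p x : S2) : E3 := (p : E3) - height p x • (x : E3)

theorem continuous_meridian (p : S2) : Continuous (meridian p) :=
  continuous_const.sub ((continuous_height p).smul continuous_subtype_val)

theorem norm_meridian_sq (p x : S2) : ‖meridian p x‖ ^ 2 = 1 - height p x ^ 2 := by
  rw [meridian, norm_sub_sq_real, norm_smul, norm_eq_of_mem_sphere x, norm_eq_of_mem_sphere p,
    inner_smul_right, real_inner_comm]
  change 1 ^ 2 - 2 * (height p x * height p x) + (‖height p x‖ * 1) ^ 2 = _
  rw [mul_one, Real.norm_eq_abs, sq_abs]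
  ring

theorem inner_self_meridian (p x : S2) : ⟪(x : E3), meridian p x⟫ = 0 := by
  rw [meridian, inner_sub_right, inner_smul_right, real_inner_self_eq_norm_sq,
    norm_eq_of_mem_sphere x]
  simp [height]

theorem inner_surfGrad_height (p x : S2) :
    ⟪surfGrad (height p) x, meridian p x⟫ = 1 - height p x ^ 2 := by
  have hx : ‖(x : E3)‖ = 1 := norm_eq_of_mem_sphere x
  have hx0 : (x : E3) ≠ 0 := ne_zero_of_mem_unit_sphere x
  rw [inner_surfGrad]
  have h1 : (fun y : E3 => height p (radialProj y)) =ᶠ[𝓝 (x : E3)]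
      fun y => ‖y‖⁻¹ * ⟪y, (p : E3)⟫ := by
    filter_upwards [isOpen_compl_singleton.mem_nhds hx0] with y hy
    rw [height, radialProj_coe hy, inner_smul_left]
    simp
  have h2 : HasFDerivAt (fun y : E3 => ⟪y, (p : E3)⟫) (innerSL ℝ (p : E3)) (x : E3) := by
    simp_rw [real_inner_comm (p : E3)]
    exact (innerSL ℝ (p : E3)).hasFDerivAt
  have h3 : HasFDerivAt (fun y : E3 => ‖y‖⁻¹) (-(innerSL ℝ (x : E3))) (x : E3) := by
    have h4 := (hasStrictFDerivAt_norm_sq (x : E3)).hasFDerivAt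
    have h5 : HasDerivAt (fun t : ℝ => (Real.sqrt t)⁻¹) (-(1 / 2)) (‖(x : E3)‖ ^ 2) := by
      have := (Real.hasDerivAt_sqrt (x := ‖(x : E3)‖ ^ 2) (by rw [hx]; norm_num)).inv
        (by rw [hx]; norm_num)
      refine this.congr_deriv ?_
      rw [hx]; norm_num
    have h6 := HasDerivAt.comp_hasFDerivAt (h₂ := fun t : ℝ => (Real.sqrt t)⁻¹)
      (f := fun y : E3 => ‖y‖ ^ 2) (x : E3) h5 h4
    refine (h6.congr_fderiv ?_).congr_of_eventuallyEq (Eventually.of_forall fun y => ?_)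
    · ext v; simp
    · simp [Real.sqrt_sq (norm_nonneg y)]
  have h7 := (h3.mul h2).congr_of_eventuallyEq h1
  rw [h7.fderiv]
  have h8 := inner_self_meridian p x
  have h9 : ⟪(p : E3), meridian p x⟫ = 1 - height p x ^ 2 := by
    rw [meridian, inner_sub_right, inner_smul_right, real_inner_self_eq_norm_sq,
      norm_eq_of_mem_sphere p, real_inner_comm]
    change 1 ^ 2 - height p x * height p x = _
    ring
  simp [hx, h8, h9]

theorem SmoothOnS2.comp_height {g : ℝ → ℝ} (p : S2)
    (hg : ∀ t ∈ Set.Icc (-1 : ℝ) 1, ContDiffAt ℝ ∞ g t) :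
    SmoothOnS2 fun x => g (height p x) := by
  intro x
  have h := (hg _ (abs_le.1 (abs_height_le_one p x))).contMDiffAt
  exact ContMDiffAt.comp (g := g) x h (smoothOnS2_height p x)

theorem SmoothOnS2.mul {u v : S2 → ℝ} (hu : SmoothOnS2 u) (hv : SmoothOnS2 v) :
    SmoothOnS2 fun x => u x * v x := ContMDiff.mul hu hv

theorem SmoothOnS2.hasFDerivAt {u : S2 → ℝ} (hu : SmoothOnS2 u) (x : S2) :
    HasFDerivAt (fun y : E3 => u (radialProj y))
      (fderiv ℝ (fun y : E3 => u (radialProj y)) (x : E3)) (x : E3) :=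
  ((hu.contDiffAt_radial (ne_zero_of_mem_unit_sphere x)).differentiableAt
    (by norm_num)).hasFDerivAt

theorem inner_surfGrad_sq_mul_comp_height {u : S2 → ℝ} (hu : SmoothOnS2 u) {g : ℝ → ℝ} (p : S2)
    (hg : ∀ t ∈ Set.Icc (-1 : ℝ) 1, ContDiffAt ℝ ∞ g t) (x : S2) :
    ⟪surfGrad (fun x => u x * u x * g (height p x)) x, meridian p x⟫
      = 2 * u x * g (height p x) * ⟪surfGrad u x, meridian p x⟫
        + u x ^ 2 * (deriv g (height p x) * (1 - height p x ^ 2)) := by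
  have h1 := hu.hasFDerivAt x
  have h2 := (smoothOnS2_height p).hasFDerivAt x
  have h3 : HasDerivAt g (deriv g (height p x)) (height p (radialProj (x : E3))) := by
    rw [radialProj_self]
    exact ((hg _ (abs_le.1 (abs_height_le_one p x))).differentiableAt (by norm_num)).hasDerivAt
  have h4 := HasDerivAt.comp_hasFDerivAt (h₂ := g) (f := fun y : E3 => height p (radialProj y))
    (x : E3) h3 h2
  have h5 := (h1.mul h1).mul h4
  have h6 : fderiv ℝ (fun y : E3 => u (radialProj y) * u (radialProj y)
      * g (height p (radialProj y))) (x : E3) = _ := h5.fderiv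
  rw [inner_surfGrad, h6, ← inner_surfGrad_height, inner_surfGrad, inner_surfGrad]
  simp [radialProj_self]
  ring

theorem integrable_surf_of_continuous {F : S2 → ℝ} (hF : Continuous F) : Integrable F surf :=
  hF.integrable_of_hasCompactSupport (HasCompactSupport.of_compactSpace _)

theorem continuous_deriv_comp_height {g : ℝ → ℝ} (p : S2)
    (hg : ∀ t ∈ Set.Icc (-1 : ℝ) 1, ContDiffAt ℝ ∞ g t) :
    Continuous fun x => deriv g (height p x) := by
  rw [continuous_iff_continuousAt]
  intro x
  have h1 := hg _ (abs_le.1 (abs_height_le_one p x))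
  have h2 : ContinuousAt (deriv g) (height p x) :=
    ((h1.fderiv_right (m := 0) (by norm_num)).continuousAt).clm_apply continuousAt_const
  exact ContinuousAt.comp (f := height p) h2 (continuous_height p).continuousAt

/-- Hardy's inequality on `𝕊²` for the test field `g(z) (p - z x)`, where `z = ⟪x, p⟫`: integrate
`0 ≤ |∇u + u g(z) (p - z x)|²`. -/
theorem integral_hardy_field_le {u : S2 → ℝ} (hu : SmoothOnS2 u) {g : ℝ → ℝ} (p : S2)
    (hg : ∀ t ∈ Set.Icc (-1 : ℝ) 1, ContDiffAt ℝ ∞ g t) :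
    ∫ x, u x ^ 2 * (deriv g (height p x) * (1 - height p x ^ 2) - 2 * height p x * g (height p x)
        - g (height p x) ^ 2 * (1 - height p x ^ 2)) ∂surf
      ≤ ∫ x, ‖surfGrad u x‖ ^ 2 ∂surf := by
  have hgs := SmoothOnS2.comp_height p hg
  have hdiv := integral_inner_surfGrad_meridian (p : E3) ((hu.mul hu).mul hgs)
  have hdiv' : ∫ x, (2 * u x * g (height p x) * ⟪surfGrad u x, meridian p x⟫
      + u x ^ 2 * (deriv g (height p x) * (1 - height p x ^ 2)
        - 2 * height p x * g (height p x))) ∂surf = 0 := by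
    rw [← hdiv]
    refine integral_congr_ae (Eventually.of_forall fun x => ?_)
    have h := inner_surfGrad_sq_mul_comp_height hu p hg x
    have h' : ⟪surfGrad (fun x => u x * u x * g (height p x)) x,
        (p : E3) - ⟪(x : E3), (p : E3)⟫ • (x : E3)⟫ = _ := h
    simp only [h']
    change _ = _ - 2 * height p x * _
    ring
  have cz := continuous_height p
  have cu := hu.continuous
  have cg : Continuous fun x => g (height p x) := hgs.continuous
  have cg' := continuous_deriv_comp_height p hg
  have cG := hu.continuous_surfGrad
  have cm := continuous_meridian p
  have hsq : ∀ x, ‖surfGrad u x‖ ^ 2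
      - u x ^ 2 * (deriv g (height p x) * (1 - height p x ^ 2) - 2 * height p x * g (height p x)
        - g (height p x) ^ 2 * (1 - height p x ^ 2))
      + (2 * u x * g (height p x) * ⟪surfGrad u x, meridian p x⟫
      + u x ^ 2 * (deriv g (height p x) * (1 - height p x ^ 2)
        - 2 * height p x * g (height p x)))
      = ‖surfGrad u x + (u x * g (height p x)) • meridian p x‖ ^ 2 := fun x => by
    rw [norm_add_sq_real, norm_smul, mul_pow, norm_meridian_sq, inner_smul_right,
      Real.norm_eq_abs, sq_abs]
    ring
  have c1 : Continuous fun x => deriv g (height p x) * (1 - height p x ^ 2)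
      - 2 * height p x * g (height p x) :=
    (cg'.mul (continuous_const.sub (cz.pow 2))).sub ((continuous_const.mul cz).mul cg)
  have i1 : Integrable (fun x => ‖surfGrad u x‖ ^ 2) surf :=
    integrable_surf_of_continuous (cG.norm.pow 2)
  have i2 : Integrable (fun x => u x ^ 2 * (deriv g (height p x) * (1 - height p x ^ 2)
      - 2 * height p x * g (height p x) - g (height p x) ^ 2 * (1 - height p x ^ 2))) surf :=
    integrable_surf_of_continuous
      ((cu.pow 2).mul (c1.sub ((cg.pow 2).mul (continuous_const.sub (cz.pow 2)))))
  have i3 : Integrable (fun x => 2 * u x * g (height p x) * ⟪surfGrad u x, meridian p x⟫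
      + u x ^ 2 * (deriv g (height p x) * (1 - height p x ^ 2)
        - 2 * height p x * g (height p x))) surf :=
    integrable_surf_of_continuous
      ((((continuous_const.mul cu).mul cg).mul (cG.inner cm)).add ((cu.pow 2).mul c1))
  have h0 : 0 ≤ ∫ x, ‖surfGrad u x + (u x * g (height p x)) • meridian p x‖ ^ 2 ∂surf :=
    integral_nonneg fun x => by positivity
  simp_rw [← hsq] at h0
  have i12 : Integrable (fun x => ‖surfGrad u x‖ ^ 2
      - u x ^ 2 * (deriv g (height p x) * (1 - height p x ^ 2) - 2 * height p x * g (height p x)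
        - g (height p x) ^ 2 * (1 - height p x ^ 2))) surf := i1.sub i2
  rw [integral_add i12 i3, integral_sub i1 i2, hdiv'] at h0
  linarith

/-! ### The regularised logarithmic field -/

/-- The regularisation `1 + log π - log (1 - c z²) / 2` of `ψ`, smooth on `[-1, 1]` if `c < 1`. For
`c = 1` and `z = cos t` it equals `ψ(t)`. -/
noncomputable def regPsi (c z : ℝ) : ℝ := 1 + Real.log Real.pi - Real.log (1 - c * z ^ 2) / 2

/-- The coefficient `-z / (2 (1 - c z²) ψ_c)` of the regularised test field. -/
noncomputable def regField (c z : ℝ) : ℝ := -z / (2 * ((1 - c * z ^ 2) * regPsi c z))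

/-- The lower bound for the Hardy weight produced by `regField c`. -/
noncomputable def regWeight (c z : ℝ) : ℝ :=
  (2 * c - 1) * (1 - z ^ 2) * z ^ 2 / (4 * (1 - c * z ^ 2) ^ 2 * regPsi c z ^ 2)
    - 1 / (2 * regPsi c z)

theorem one_add_log_pi_le_regPsi {c z : ℝ} (hc : 0 ≤ c) (hq : 0 < 1 - c * z ^ 2) :
    1 + Real.log Real.pi ≤ regPsi c z := by
  have : Real.log (1 - c * z ^ 2) ≤ 0 :=
    Real.log_nonpos hq.le (by nlinarith [mul_nonneg hc (sq_nonneg z)])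
  rw [regPsi]
  linarith

theorem one_add_log_pi_pos : 0 < 1 + Real.log Real.pi := by
  linarith [log_pi_bounds.1]

theorem one_sub_mul_sq_pos {c z : ℝ} (hc : c < 1) (hz : z ^ 2 ≤ 1) : 0 < 1 - c * z ^ 2 := by
  rcases le_total c 0 with h | h
  · nlinarith [mul_nonneg (neg_nonneg.2 h) (sq_nonneg z)]
  · nlinarith

theorem contDiffAt_regField {c : ℝ} (hc0 : 0 ≤ c) (hc : c < 1) :
    ∀ t ∈ Set.Icc (-1 : ℝ) 1, ContDiffAt ℝ ∞ (regField c) t := by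
  intro t ht
  have hq := one_sub_mul_sq_pos hc ((sq_le_one_iff_abs_le_one t).2 (abs_le.2 ht))
  have hp := one_add_log_pi_pos.trans_le (one_add_log_pi_le_regPsi hc0 hq)
  have h1 : ContDiffAt ℝ ∞ (fun z : ℝ => 1 - c * z ^ 2) t := by fun_prop
  have h2 : ContDiffAt ℝ ∞ (regPsi c) t := contDiffAt_const.sub ((h1.log hq.ne').div_const 2)
  exact contDiffAt_id.neg.div (contDiffAt_const.mul (h1.mul h2)) (by simp; exact ⟨hq.ne', hp.ne'⟩)

theorem hasDerivAt_regField {c z : ℝ} (hc0 : 0 ≤ c) (hc : c < 1) (hz : z ^ 2 ≤ 1) :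
    HasDerivAt (regField c) (-1 / (2 * ((1 - c * z ^ 2) * regPsi c z))
      + c * z ^ 2 * (1 - 2 * regPsi c z) / (2 * ((1 - c * z ^ 2) * regPsi c z) ^ 2)) z := by
  have hq := one_sub_mul_sq_pos hc hz
  have hp := one_add_log_pi_pos.trans_le (one_add_log_pi_le_regPsi hc0 hq)
  have h1 : HasDerivAt (fun z : ℝ => 1 - c * z ^ 2) (-(2 * c * z)) z := by
    have := ((hasDerivAt_pow 2 z).const_mul c).const_sub 1
    refine this.congr_deriv ?_
    simp; ring
  have h2 : HasDerivAt (regPsi c) (c * z / (1 - c * z ^ 2)) z := by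
    refine (((h1.log hq.ne').div_const 2).const_sub _).congr_deriv ?_
    field_simp
  have h3 := (hasDerivAt_id z).neg.div ((h1.mul h2).const_mul 2)
    (mul_ne_zero two_ne_zero (mul_ne_zero hq.ne' hp.ne'))
  refine h3.congr_deriv ?_
  simp only [Pi.mul_apply, Pi.neg_apply, id]
  generalize regPsi c z = ψ at *
  generalize hqq : 1 - c * z ^ 2 = q at *
  field_simp
  ring

theorem regWeight_le {c z : ℝ} (hc0 : 0 ≤ c) (hc : c < 1) (hz : z ^ 2 ≤ 1) :
    regWeight c z ≤ deriv (regField c) z * (1 - z ^ 2) - 2 * z * regField c z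
      - regField c z ^ 2 * (1 - z ^ 2) := by
  have hq := one_sub_mul_sq_pos hc hz
  have hp := one_add_log_pi_pos.trans_le (one_add_log_pi_le_regPsi hc0 hq)
  rw [(hasDerivAt_regField hc0 hc hz).deriv, regField, regWeight]
  generalize regPsi c z = ψ at *
  have key : (-1 / (2 * ((1 - c * z ^ 2) * ψ))
      + c * z ^ 2 * (1 - 2 * ψ) / (2 * ((1 - c * z ^ 2) * ψ) ^ 2)) * (1 - z ^ 2)
      - 2 * z * (-z / (2 * ((1 - c * z ^ 2) * ψ)))
      - (-z / (2 * ((1 - c * z ^ 2) * ψ))) ^ 2 * (1 - z ^ 2)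
      - ((2 * c - 1) * (1 - z ^ 2) * z ^ 2 / (4 * (1 - c * z ^ 2) ^ 2 * ψ ^ 2) - 1 / (2 * ψ))
      = (1 - c) * z ^ 2 / (2 * (1 - c * z ^ 2) * ψ)
        + (1 - c) * z ^ 2 / ((1 - c * z ^ 2) ^ 2 * ψ) := by
    obtain ⟨q, hqq⟩ : ∃ q, q = 1 - c * z ^ 2 := ⟨_, rfl⟩
    have hcz : c * z ^ 2 = 1 - q := by rw [hqq]; ring
    rw [← hqq] at hq ⊢
    field_simp
    rw [hqq]
    ring
  have h1 : 0 ≤ (1 - c) * z ^ 2 := mul_nonneg (by linarith) (sq_nonneg z)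
  have h2 : 0 ≤ (1 - c) * z ^ 2 / (2 * (1 - c * z ^ 2) * ψ)
        + (1 - c) * z ^ 2 / ((1 - c * z ^ 2) ^ 2 * ψ) := by positivity
  linarith

theorem regWeight_add_nonneg {c z : ℝ} (hc : 1 / 2 ≤ c) (hz : z ^ 2 ≤ 1)
    (hq : 0 < 1 - c * z ^ 2) : 0 ≤ regWeight c z + 1 / (2 * (1 + Real.log Real.pi)) := by
  have hp := one_add_log_pi_le_regPsi (by linarith) hq
  have hp0 := one_add_log_pi_pos
  have h1 : 1 / (2 * regPsi c z) ≤ 1 / (2 * (1 + Real.log Real.pi)) := by gcongr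
  have h2 : 0 ≤ (2 * c - 1) * (1 - z ^ 2) * z ^ 2
      / (4 * (1 - c * z ^ 2) ^ 2 * regPsi c z ^ 2) := by
    have : 0 ≤ 2 * c - 1 := by linarith
    have : 0 ≤ 1 - z ^ 2 := by linarith
    positivity
  rw [regWeight]
  linarith

theorem tendsto_regWeight {z : ℝ} (hz : z ^ 2 < 1) {c : ℕ → ℝ} (hc : Tendsto c atTop (𝓝 1)) :
    Tendsto (fun n => regWeight (c n) z) atTop (𝓝 (regWeight 1 z)) := by
  have hq : 0 < 1 - 1 * z ^ 2 := by linarith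
  have hp := one_add_log_pi_pos.trans_le (one_add_log_pi_le_regPsi zero_le_one hq)
  have hcont : ContinuousAt (fun c => regWeight c z) 1 := by
    have h1 : ContinuousAt (fun c : ℝ => 1 - c * z ^ 2) 1 := by fun_prop
    have h2 : ContinuousAt (fun c : ℝ => regPsi c z) 1 :=
      continuousAt_const.sub ((h1.log hq.ne').div_const 2)
    have h3 : 4 * (1 - 1 * z ^ 2) ^ 2 * regPsi 1 z ^ 2 ≠ 0 := by positivity
    have h4 : 2 * regPsi 1 z ≠ 0 := by positivity
    have h5 : ContinuousAt (fun c : ℝ => (2 * c - 1) * (1 - z ^ 2) * z ^ 2) 1 := by fun_prop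
    have h6 := ((h1.pow 2).const_mul 4).mul (h2.pow 2)
    exact (h5.div h6 h3).sub (continuousAt_const.div (h2.const_mul 2) h4)
  exact hcont.tendsto.comp hc

theorem continuous_regWeight_height {c : ℝ} (hc0 : 0 ≤ c) (hc : c < 1) (p : S2) :
    Continuous fun x => regWeight c (height p x) := by
  have cz := continuous_height p
  have hq : ∀ x, 0 < 1 - c * height p x ^ 2 := fun x =>
    one_sub_mul_sq_pos hc (height_sq_le_one p x)
  have hp : ∀ x, 0 < regPsi c (height p x) := fun x =>
    one_add_log_pi_pos.trans_le (one_add_log_pi_le_regPsi hc0 (hq x))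
  have h1 : Continuous fun x => 1 - c * height p x ^ 2 := by fun_prop
  have h2 : Continuous fun x => regPsi c (height p x) :=
    continuous_const.sub ((h1.log fun x => (hq x).ne').div_const 2)
  refine (Continuous.div (by fun_prop) (by fun_prop) fun x => ?_).sub
    (Continuous.div (by fun_prop) (by fun_prop) fun x => ?_)
  · have := hq x; have := hp x; positivity
  · have := hp x; positivity

/-- Fatou's lemma for an almost everywhere convergent sequence with bounded integrals. -/
theorem lintegral_le_of_tendsto_ae {α : Type*} [MeasurableSpace α] {μ : Measure α}
    {F : ℕ → α → ℝ≥0∞} {G : α → ℝ≥0∞} {R : ℕ → ℝ≥0∞} {S : ℝ≥0∞}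
    (hF : ∀ n, AEMeasurable (F n) μ)
    (hlim : ∀ᵐ x ∂μ, Tendsto (fun n => F n x) atTop (𝓝 (G x)))
    (hle : ∀ n, ∫⁻ x, F n x ∂μ ≤ R n) (hR : Tendsto R atTop (𝓝 S)) :
    ∫⁻ x, G x ∂μ ≤ S :=
  calc ∫⁻ x, G x ∂μ = ∫⁻ x, liminf (fun n => F n x) atTop ∂μ :=
        lintegral_congr_ae (hlim.mono fun x hx => hx.liminf_eq.symm)
    _ ≤ liminf (fun n => ∫⁻ x, F n x ∂μ) atTop := lintegral_liminf_le' hF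
    _ ≤ liminf R atTop := liminf_le_liminf (Eventually.of_forall hle)
    _ = S := hR.liminf_eq

theorem lintegral_ofReal_norm_sq {α E : Type*} [MeasurableSpace α] {μ : Measure α}
    [NormedAddCommGroup E] [InnerProductSpace ℝ E] (f : Lp E 2 μ) :
    ∫⁻ x, ENNReal.ofReal (‖f x‖ ^ 2) ∂μ = ENNReal.ofReal (‖f‖ ^ 2) := by
  have h := L2.integrable_inner (𝕜 := ℝ) f f
  have h2 := L2.inner_def (𝕜 := ℝ) f f
  simp only [real_inner_self_eq_norm_sq] at h h2
  rw [h2, ofReal_integral_eq_lintegral_ofReal h (Eventually.of_forall fun x => by positivity)]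

/-! ### Null sets -/

theorem surf_submodule_eq_zero {V : Submodule ℝ E3} (hV : V ≠ ⊤) :
    surf {x : S2 | (x : E3) ∈ V} = 0 := by
  have hcl : IsClosed {x : S2 | (x : E3) ∈ V} :=
    V.closed_of_finiteDimensional.preimage continuous_subtype_val
  rw [Measure.toSphere_apply' _ hcl.measurableSet]
  refine mul_eq_zero_of_right _ (measure_mono_null ?_
    (Measure.addHaar_submodule (volume : Measure E3) V hV))
  rintro _ ⟨r, _, _, ⟨x, hx, rfl⟩, rfl⟩
  exact V.smul_mem r hx

theorem ae_height_ne_zero (p : S2) : ∀ᵐ x ∂surf, height p x ≠ 0 := by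
  have hp : (p : E3) ≠ 0 := ne_zero_of_mem_unit_sphere p
  have hV : (ℝ ∙ (p : E3))ᗮ ≠ ⊤ := by
    intro h
    have : (p : E3) ∈ (ℝ ∙ (p : E3))ᗮ := h ▸ Submodule.mem_top
    rw [Submodule.mem_orthogonal_singleton_iff_inner_left] at this
    exact hp (inner_self_eq_zero.1 this)
  refine measure_mono_null (fun x hx => ?_) (surf_submodule_eq_zero hV)
  have hx' : height p x = 0 := not_not.1 hx
  exact (Submodule.mem_orthogonal_singleton_iff_inner_left).2 hx'

theorem ae_height_sq_lt_one (p : S2) : ∀ᵐ x ∂surf, height p x ^ 2 < 1 := by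
  have hV : (ℝ ∙ (p : E3)) ≠ ⊤ := by
    intro h
    have h1 := finrank_span_singleton (K := ℝ) (ne_zero_of_mem_unit_sphere p : (p : E3) ≠ 0)
    rw [h, finrank_top, finrank_euclideanSpace_fin] at h1
    norm_num at h1
  refine measure_mono_null (fun x hx => ?_) (surf_submodule_eq_zero hV)
  have hx1 : height p x ^ 2 = 1 := le_antisymm (height_sq_le_one p x) (not_lt.1 hx)
  -- The field `p - ⟪x, p⟫ x` vanishes exactly at the poles.
  have h := norm_meridian_sq p x
  rw [hx1, sub_self, sq_eq_zero_iff, norm_eq_zero, meridian, sub_eq_zero] at h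
  refine Submodule.mem_span_singleton.2 ⟨height p x, ?_⟩
  rw [h, smul_smul, ← sq, hx1, one_smul]

/-! ### Hardy's inequality on `H¹(𝕊²)` -/

theorem SmoothOnS2.lintegral_regWeight_le {u : S2 → ℝ} (hu : SmoothOnS2 u) (p : S2) {c : ℝ}
    (hc0 : 1 / 2 ≤ c) (hc : c < 1) :
    ∫⁻ x, ENNReal.ofReal (u x ^ 2 * (regWeight c (height p x)
        + 1 / (2 * (1 + Real.log Real.pi)))) ∂surf
      ≤ ∫⁻ x, ENNReal.ofReal (‖surfGrad u x‖ ^ 2) ∂surf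
        + ENNReal.ofReal (1 / (2 * (1 + Real.log Real.pi)))
          * ∫⁻ x, ENNReal.ofReal (u x ^ 2) ∂surf := by
  have hc0' : 0 ≤ c := by linarith
  have hk : 0 ≤ 1 / (2 * (1 + Real.log Real.pi)) := by
    have := one_add_log_pi_pos; positivity
  set k := 1 / (2 * (1 + Real.log Real.pi)) with hkdef
  have cu := hu.continuous
  have cw := continuous_regWeight_height hc0' hc p
  have hfield := integral_hardy_field_le hu p (contDiffAt_regField hc0' hc)
  have i0 : Integrable (fun x => u x ^ 2 * regWeight c (height p x)) surf :=
    integrable_surf_of_continuous ((cu.pow 2).mul cw)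
  have i1 : Integrable (fun x => u x ^ 2) surf := integrable_surf_of_continuous (cu.pow 2)
  have i2 : Integrable (fun x => ‖surfGrad u x‖ ^ 2) surf :=
    integrable_surf_of_continuous (hu.continuous_surfGrad.norm.pow 2)
  have i3 : Integrable (fun x => u x ^ 2 * (regWeight c (height p x) + k)) surf :=
    integrable_surf_of_continuous ((cu.pow 2).mul (cw.add continuous_const))
  have hle : ∫ x, u x ^ 2 * regWeight c (height p x) ∂surf ≤ ∫ x, ‖surfGrad u x‖ ^ 2 ∂surf := by
    refine le_trans (integral_mono i0 ?_ fun x => ?_) hfield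
    · refine integrable_surf_of_continuous ((cu.pow 2).mul ?_)
      have cz := continuous_height p
      have cg := (SmoothOnS2.comp_height p (contDiffAt_regField hc0' hc)).continuous
      have cg' := continuous_deriv_comp_height p (contDiffAt_regField hc0' hc)
      exact ((cg'.mul (continuous_const.sub (cz.pow 2))).sub ((continuous_const.mul cz).mul cg)).sub
        ((cg.pow 2).mul (continuous_const.sub (cz.pow 2)))
    · exact mul_le_mul_of_nonneg_left (regWeight_le hc0' hc (height_sq_le_one p x))
        (sq_nonneg _)
  have hnn : ∀ x, 0 ≤ regWeight c (height p x) + k := fun x =>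
    regWeight_add_nonneg hc0 (height_sq_le_one p x)
      (one_sub_mul_sq_pos hc (height_sq_le_one p x))
  have hsum : ∫ x, u x ^ 2 * (regWeight c (height p x) + k) ∂surf
      ≤ ∫ x, ‖surfGrad u x‖ ^ 2 ∂surf + k * ∫ x, u x ^ 2 ∂surf := by
    simp_rw [mul_add]
    rw [integral_add i0 (i1.mul_const k), integral_mul_const]
    linarith
  rw [← ofReal_integral_eq_lintegral_ofReal i3
      (Eventually.of_forall fun x => mul_nonneg (sq_nonneg _) (hnn x)),
    ← ofReal_integral_eq_lintegral_ofReal i2 (Eventually.of_forall fun x => by positivity),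
    ← ofReal_integral_eq_lintegral_ofReal i1 (Eventually.of_forall fun x => by positivity),
    ← ENNReal.ofReal_mul hk, ← ENNReal.ofReal_add (integral_nonneg fun x => by positivity)
      (mul_nonneg hk (integral_nonneg fun x => by positivity))]
  exact ENNReal.ofReal_le_ofReal hsum

/-- The limit `c → 1` of the regularised inequality. The constant `1 / (2 (1 + log π))` makes the
integrands nonnegative, as Fatou's lemma requires. -/
theorem SmoothOnS2.lintegral_hardy_le {u : S2 → ℝ} (hu : SmoothOnS2 u) (p : S2) :
    ∫⁻ x, ENNReal.ofReal (u x ^ 2 * (regWeight 1 (height p x)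
        + 1 / (2 * (1 + Real.log Real.pi)))) ∂surf
      ≤ ∫⁻ x, ENNReal.ofReal (‖surfGrad u x‖ ^ 2) ∂surf
        + ENNReal.ofReal (1 / (2 * (1 + Real.log Real.pi)))
          * ∫⁻ x, ENNReal.ofReal (u x ^ 2) ∂surf := by
  let c : ℕ → ℝ := fun n => 1 - 1 / ((n : ℝ) + 1 + 1)
  have hc : Tendsto c atTop (𝓝 1) := by
    have h := (tendsto_one_div_add_atTop_nhds_zero_nat (𝕜 := ℝ)).comp (tendsto_add_atTop_nat 1)
    have h2 := h.const_sub 1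
    rw [sub_zero] at h2
    refine h2.congr fun n => ?_
    simp [c]
  have hc1 : ∀ n, c n < 1 := fun n => by
    have : 0 < 1 / ((n : ℝ) + 1 + 1) := by positivity
    simp only [c]; linarith
  have hc0 : ∀ n, 1 / 2 ≤ c n := fun n => by
    have : 1 / ((n : ℝ) + 1 + 1) ≤ 1 / 2 := by
      apply one_div_le_one_div_of_le (by norm_num)
      have : (0 : ℝ) ≤ n := n.cast_nonneg
      linarith
    simp only [c]; linarith
  refine lintegral_le_of_tendsto_ae (F := fun n x => ENNReal.ofReal (u x ^ 2 *
      (regWeight (c n) (height p x) + 1 / (2 * (1 + Real.log Real.pi))))) (fun n => ?_) ?_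
    (fun n => hu.lintegral_regWeight_le p (hc0 n) (hc1 n)) tendsto_const_nhds
  · have h1 := continuous_regWeight_height (by linarith [hc0 n]) (hc1 n) p
    exact ((hu.continuous.pow 2).mul
      (h1.add continuous_const)).measurable.ennreal_ofReal.aemeasurable
  · filter_upwards [ae_height_sq_lt_one p] with x hx
    exact ENNReal.tendsto_ofReal (((tendsto_regWeight hx hc).add_const _).const_mul _)

theorem measurable_regWeight_height (c : ℝ) (p : S2) :
    Measurable fun x => regWeight c (height p x) := by
  have hz := (continuous_height p).measurable
  unfold regWeight regPsi
  fun_prop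

/-- The inequality passes to the completion by Fatou's lemma along an almost everywhere convergent
subsequence, the right-hand side being continuous in the norm of `L2Pair`. -/
theorem lintegral_hardy_le_of_mem_H1S2 {w : L2Pair} (hw : w ∈ H1S2) (p : S2) :
    ∫⁻ x, ENNReal.ofReal (w.fst x ^ 2 * (regWeight 1 (height p x)
        + 1 / (2 * (1 + Real.log Real.pi)))) ∂surf
      ≤ ∫⁻ x, ENNReal.ofReal (‖w.snd x‖ ^ 2) ∂surf
        + ENNReal.ofReal (1 / (2 * (1 + Real.log Real.pi)))
          * ∫⁻ x, ENNReal.ofReal (w.fst x ^ 2) ∂surf := by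
  obtain ⟨v, hv, hlim⟩ := mem_closure_iff_seq_limit.1 hw
  have hfst : Tendsto (fun n => (v n).fst) atTop (𝓝 w.fst) :=
    ((WithLp.continuous_fst 2 _ _).tendsto w).comp hlim
  have hsnd : Tendsto (fun n => (v n).snd) atTop (𝓝 w.snd) :=
    ((WithLp.continuous_snd 2 _ _).tendsto w).comp hlim
  obtain ⟨ns, hns, hae⟩ := (tendstoInMeasure_of_tendsto_Lp hfst).exists_seq_tendsto_ae
  have hns' := hns.tendsto_atTop
  have hsq : ∀ f : Lp ℝ 2 surf, ∫⁻ x, ENNReal.ofReal (f x ^ 2) ∂surf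
      = ENNReal.ofReal (‖f‖ ^ 2) := fun f => by
    rw [← lintegral_ofReal_norm_sq]
    simp
  refine lintegral_le_of_tendsto_ae (F := fun n x => ENNReal.ofReal ((v (ns n)).fst x ^ 2 *
      (regWeight 1 (height p x) + 1 / (2 * (1 + Real.log Real.pi)))))
    (R := fun n => ∫⁻ x, ENNReal.ofReal (‖(v (ns n)).snd x‖ ^ 2) ∂surf
        + ENNReal.ofReal (1 / (2 * (1 + Real.log Real.pi)))
          * ∫⁻ x, ENNReal.ofReal ((v (ns n)).fst x ^ 2) ∂surf) (fun n => ?_) ?_ (fun n => ?_) ?_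
  · have h1 := (Lp.aestronglyMeasurable (v (ns n)).fst).aemeasurable
    have h2 := measurable_regWeight_height 1 p
    exact ((h1.pow_const 2).mul (h2.add_const _).aemeasurable).ennreal_ofReal
  · filter_upwards [hae] with x hx
    exact ENNReal.tendsto_ofReal ((hx.pow 2).mul_const _)
  · obtain ⟨u, hu, h1, h2⟩ := hv (ns n)
    have h := hu.lintegral_hardy_le p
    refine (le_of_eq ?_).trans (h.trans (le_of_eq ?_))
    · exact lintegral_congr_ae (h1.mono fun x hx => by simp only [hx])
    · congr 1
      · exact lintegral_congr_ae (h2.mono fun x hx => by simp only [hx])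
      · congr 1
        exact lintegral_congr_ae (h1.mono fun x hx => by simp only [hx])
  · simp only [hsq, lintegral_ofReal_norm_sq]
    refine Tendsto.add ?_ ?_
    · exact ENNReal.tendsto_ofReal ((((hsnd.comp hns').norm).pow 2))
    · exact ENNReal.Tendsto.const_mul (ENNReal.tendsto_ofReal (((hfst.comp hns').norm).pow 2))
        (Or.inr ENNReal.ofReal_ne_top)

/-! ### Nonattainment -/

theorem cos_geoDist (p x : S2) : Real.cos (geoDist x p) = height p x := by
  rw [geoDist, InnerProductGeometry.cos_angle, norm_eq_of_mem_sphere x, norm_eq_of_mem_sphere p,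
    one_mul, div_one, height]

theorem geoDist_mem_Ioo {p x : S2} (h : height p x ^ 2 < 1) :
    geoDist x p ∈ Set.Ioo 0 Real.pi := by
  have h0 : geoDist x p ≠ 0 := fun h0 => by
    rw [← cos_geoDist, h0, Real.cos_zero] at h; norm_num at h
  have h1 : geoDist x p ≠ Real.pi := fun h1 => by
    rw [← cos_geoDist, h1, Real.cos_pi] at h; norm_num at h
  exact ⟨lt_of_le_of_ne (InnerProductGeometry.angle_nonneg _ _) h0.symm,
    lt_of_le_of_ne (InnerProductGeometry.angle_le_pi _ _) h1⟩

theorem hardyWeight_geoDist {p x : S2} (h : height p x ^ 2 < 1) :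
    hardyWeight (geoDist x p) = regWeight 1 (height p x) := by
  obtain ⟨h0, h1⟩ := geoDist_mem_Ioo h
  have hs := Real.sin_pos_of_pos_of_lt_pi h0 h1
  have hsq : 1 - 1 * height p x ^ 2 = Real.sin (geoDist x p) ^ 2 := by
    rw [← cos_geoDist, Real.sin_sq]; ring
  have hsq' : 1 - height p x ^ 2 = Real.sin (geoDist x p) ^ 2 := by rw [← hsq]; ring
  have hpsi : regPsi 1 (height p x) = psi (geoDist x p) := by
    rw [regPsi, hsq, psi, phi_eq hs, Real.log_pow]
    push_cast
    ring
  have hp : 0 < psi (geoDist x p) := one_add_log_pi_pos.trans_le (one_add_log_pi_le_psi h0 h1)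
  rw [hardyWeight, regWeight, hpsi, hsq, hsq', cos_geoDist]
  congr 1
  field_simp
  ring

/-- Nonattainment for any profile `η` whose weight is strictly dominated by the Hardy weight plus
`C / 4` away from the poles and the equator. -/
theorem QFun_ne_TFun {η : ℝ → ℝ} {C D : ℝ} (hη : Measurable η)
    (hC : 2 / (1 + Real.log Real.pi) ≤ C) (hCD : C ≤ D)
    (hlt : ∀ t, 0 < t → t < Real.pi → t ≠ Real.pi / 2 →
      1 / 4 * (1 / rho η t ^ 2 + 1 / rho η (Real.pi - t) ^ 2) < hardyWeight t + C / 4)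
    (p : S2) {f : L2Pair} (hf : f ∈ H1S2) (hf0 : f ≠ 0) : QFun η p f ≠ TFun D f := by
  intro heq
  set k := 1 / (2 * (1 + Real.log Real.pi)) with hk
  have hk0 : 0 ≤ k := by have := one_add_log_pi_pos; positivity
  set m := C / 4 - k with hm
  have hm0 : 0 ≤ m := by
    have : k = 2 / (1 + Real.log Real.pi) / 4 := by rw [hk]; field_simp; norm_num
    rw [hm, this]; linarith
  have hsq : ∫⁻ x, ENNReal.ofReal (f.fst x ^ 2) ∂surf = ENNReal.ofReal (‖f.fst‖ ^ 2) := by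
    rw [← lintegral_ofReal_norm_sq]
    simp
  have hTfin : TFun D f ≠ ⊤ := by
    rw [TFun, lintegral_ofReal_norm_sq, hsq]
    exact ENNReal.add_ne_top.2 ⟨ENNReal.ofReal_ne_top,
      ENNReal.mul_ne_top ENNReal.ofReal_ne_top ENNReal.ofReal_ne_top⟩
  have hfm := (Lp.aestronglyMeasurable f.fst).aemeasurable
  have hfm2 := hfm.pow_const 2
  have hgeo : Measurable fun x : S2 => geoDist x p := by
    have : (fun x : S2 => geoDist x p) = fun x => Real.arccos (height p x) := by
      funext x
      rw [← cos_geoDist]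
      exact (Real.arccos_cos (InnerProductGeometry.angle_nonneg _ _)
        (InnerProductGeometry.angle_le_pi _ _)).symm
    rw [this]
    exact (Real.continuous_arccos.comp (continuous_height p)).measurable
  set q : S2 → ℝ := fun x => 1 / 4 * (1 / rho η (geoDist x p) ^ 2
    + 1 / rho η (Real.pi - geoDist x p) ^ 2) with hq
  have hrho : Measurable (rho η) := measurable_id.mul hη
  have hqm : Measurable q :=
    ((((hrho.comp hgeo).pow_const 2).const_div 1).add
      (((hrho.comp (hgeo.const_sub Real.pi)).pow_const 2).const_div 1)).const_mul _
  have hq0 : ∀ x, 0 ≤ q x := fun x => by simp only [hq]; positivity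
  have hQ : QFun η p f = ∫⁻ x, ENNReal.ofReal (f.fst x ^ 2 * q x) ∂surf := by
    rw [QFun, ← lintegral_const_mul' _ _ ENNReal.ofReal_ne_top]
    refine lintegral_congr fun x => ?_
    rw [← ENNReal.ofReal_mul (by norm_num)]
    congr 1
    simp only [hq]
    ring
  set gap : S2 → ℝ := fun x => regWeight 1 (height p x) + C / 4 - q x with hgap
  have hgapm : Measurable gap :=
    ((measurable_regWeight_height 1 p).add_const _).sub hqm
  have hgap_pos : ∀ᵐ x ∂surf, 0 < gap x := by
    filter_upwards [ae_height_ne_zero p, ae_height_sq_lt_one p] with x h1 h2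
    obtain ⟨h3, h4⟩ := geoDist_mem_Ioo h2
    have h5 : geoDist x p ≠ Real.pi / 2 := fun h => by
      rw [← cos_geoDist, h, Real.cos_pi_div_two] at h1
      exact h1 rfl
    have h6 := hlt _ h3 h4 h5
    rw [hardyWeight_geoDist h2] at h6
    exact sub_pos.2 h6
  have mq : AEMeasurable (fun x => ENNReal.ofReal (f.fst x ^ 2 * q x)) surf :=
    (hfm2.mul hqm.aemeasurable).ennreal_ofReal
  have mgap : AEMeasurable (fun x => ENNReal.ofReal (f.fst x ^ 2 * gap x)) surf :=
    (hfm2.mul hgapm.aemeasurable).ennreal_ofReal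
  have mw : AEMeasurable
      (fun x => ENNReal.ofReal (f.fst x ^ 2 * (regWeight 1 (height p x) + k))) surf :=
    (hfm2.mul ((measurable_regWeight_height 1 p).add_const k).aemeasurable).ennreal_ofReal
  -- `q + gap = (weight + k) + m`, split into nonnegative parts.
  have hsplit : ∫⁻ x, ENNReal.ofReal (f.fst x ^ 2 * q x) ∂surf
        + ∫⁻ x, ENNReal.ofReal (f.fst x ^ 2 * gap x) ∂surf
      = ∫⁻ x, ENNReal.ofReal (f.fst x ^ 2 * (regWeight 1 (height p x) + k)) ∂surf
        + ENNReal.ofReal m * ∫⁻ x, ENNReal.ofReal (f.fst x ^ 2) ∂surf := by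
    rw [← lintegral_const_mul' _ _ ENNReal.ofReal_ne_top,
      ← lintegral_add_left' mq, ← lintegral_add_left' mw]
    refine lintegral_congr_ae ?_
    filter_upwards [hgap_pos, ae_height_sq_lt_one p] with x hx hx1
    have hw : 0 ≤ regWeight 1 (height p x) + k :=
      regWeight_add_nonneg (by norm_num) hx1.le (by linarith)
    rw [← ENNReal.ofReal_mul hm0,
      ← ENNReal.ofReal_add (mul_nonneg (sq_nonneg _) (hq0 x))
        (mul_nonneg (sq_nonneg _) hx.le),
      ← ENNReal.ofReal_add (mul_nonneg (sq_nonneg _) hw) (mul_nonneg hm0 (sq_nonneg _))]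
    congr 1
    simp only [hgap, hm]
    ring
  have hle : QFun η p f + ∫⁻ x, ENNReal.ofReal (f.fst x ^ 2 * gap x) ∂surf ≤ TFun D f := by
    rw [hQ, hsplit, TFun]
    calc _ ≤ (∫⁻ x, ENNReal.ofReal (‖f.snd x‖ ^ 2) ∂surf
          + ENNReal.ofReal k * ∫⁻ x, ENNReal.ofReal (f.fst x ^ 2) ∂surf)
          + ENNReal.ofReal m * ∫⁻ x, ENNReal.ofReal (f.fst x ^ 2) ∂surf := by
          gcongr
          exact lintegral_hardy_le_of_mem_H1S2 hf p
      _ = ∫⁻ x, ENNReal.ofReal (‖f.snd x‖ ^ 2) ∂surf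
          + ENNReal.ofReal (C / 4) * ∫⁻ x, ENNReal.ofReal (f.fst x ^ 2) ∂surf := by
          rw [add_assoc, ← add_mul, ← ENNReal.ofReal_add hk0 hm0, hm, add_sub_cancel]
      _ ≤ _ := by gcongr
  have hgap0 : ∫⁻ x, ENNReal.ofReal (f.fst x ^ 2 * gap x) ∂surf = 0 := by
    rw [heq] at hle
    have : TFun D f + ∫⁻ x, ENNReal.ofReal (f.fst x ^ 2 * gap x) ∂surf ≤ TFun D f + 0 := by
      rwa [add_zero]
    exact le_antisymm ((ENNReal.add_le_add_iff_left hTfin).1 this) zero_le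
  rw [lintegral_eq_zero_iff' mgap] at hgap0
  have hfst : f.fst =ᵐ[surf] (0 : S2 → ℝ) := by
    filter_upwards [hgap0, hgap_pos] with x h1 h2
    have h3 : f.fst x ^ 2 * gap x ≤ 0 := ENNReal.ofReal_eq_zero.1 h1
    have h4 : f.fst x ^ 2 ≤ 0 := nonpos_of_mul_nonpos_left h3 h2
    exact pow_eq_zero_iff (two_ne_zero) |>.1 (le_antisymm h4 (sq_nonneg _))
  have hfst0 : f.fst = 0 := Lp.eq_zero_iff_ae_eq_zero.2 hfst
  -- With `f = 0` both sides of the assumed equality reduce to `0 = ‖∇f‖²`.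
  have hQ0 : QFun η p f = 0 := by
    rw [hQ, lintegral_eq_zero_iff' mq]
    filter_upwards [hfst] with x hx
    simp [hx]
  rw [hQ0, TFun, lintegral_ofReal_norm_sq] at heq
  have hsnd0 : f.snd = 0 := by
    have h := (add_eq_zero.1 heq.symm).1
    rw [ENNReal.ofReal_eq_zero] at h
    exact norm_eq_zero.1 (pow_eq_zero_iff (two_ne_zero) |>.1 (le_antisymm h (sq_nonneg _)))
  exact hf0 (WithLp.ofLp_injective 2 (Prod.ext hfst0 hsnd0))

theorem measurable_phi : Measurable phi :=
  Real.measurable_log.comp (measurable_id.const_div _)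

theorem measurable_psi : Measurable psi := measurable_phi.comp Real.measurable_sin

theorem theorem3 (p : S2) (A B : ℝ) (hA : constA ≤ A) (hB : constB ≤ B) :
    (¬ ∃ f : L2Pair, f ∈ H1S2 ∧ f ≠ 0 ∧ QFun phi p f = TFun A f) ∧
    (¬ ∃ f : L2Pair, f ∈ H1S2 ∧ f ≠ 0 ∧ QFun psi p f = TFun B f) := by
  have h2 : 0 < 1 + Real.log 2 := by linarith [Real.log_two_gt_d9]
  constructor
  · rintro ⟨f, hf, hf0, h⟩
    exact QFun_ne_TFun measurable_phi (by rw [constA]; exact le_add_of_nonneg_right (by positivity))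
      hA (fun _ => rho_phi_weight_lt) p hf hf0 h
  · rintro ⟨f, hf, hf0, h⟩
    exact QFun_ne_TFun measurable_psi (by rw [constB]; exact le_add_of_nonneg_right (by positivity))
      hB (fun _ => rho_psi_weight_lt) p hf hf0 h
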